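/- **Setting.** Let $K$ be a field and let $\Gamma$ be a pointed affine semigroup, that is, a commutative, finitely generated, cancellative, torsion-free semigroup with origin $0$, whose only invertible element is $0$. Let $M$ be the lattice generated by the differences of elements of $\Gamma$, $N$ its dual lattice, $\check\sigma\subseteq M_{\mathbb R}$ the cone generated by $\Gamma$ and $\sigma\subseteq N_{\mathbb R}$ its dual cone. Write $\overline{\mathbb R}=\mathbb R\cup\{+\infty\}$, let $L(\sigma,N)$ be the space of semigroup morphisms $\check\sigma\cap M\to\overline{\mathbb R}$ (sending $0$ to $0$) with the topology of pointwise convergence, let $\overline\sigma\subseteq L(\sigma,N)$ be the extended cone, i.e. the set of morphisms with values in $[0,+\infty]$, and let $\overline\sigma^\circ\subseteq\overline\sigma$ be the set of those morphisms which are positive (possibly $+\infty$) on all non-invertible elements of $\check\sigma\cap M$. Every semigroup morphism $\Gamma\to\overline{\mathbb R}$ extends uniquely to $\check\sigma\cap M$ and is thus regarded as a point of $L(\sigma,N)$. Let $K[[\Gamma]]$ be the ring of formal series $\sum_{m\in\Gamma}a_m\chi^m$ with $a_m\in K$, let $I$ be an ideal of $K[[\Gamma]]$, let $R=K[[\Gamma]]/I$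 and let $\gamma\colon(\Gamma,+)\to(R,\cdot)$ be the natural morphism $m\mapsto\chi^m \bmod I$. A valuation of $R$ is a map $v\colon R\to\overline{\mathbb R}$ with $v(0)=+\infty$, $v(1)=0$, $v(fg)=v(f)+v(g)$ and $v(f+g)\ge\min\{v(f),v(g)\}$. The *local nonnegative tropicalization* $\mathrm{nntrop}(I)$ is the set of all $v\circ\gamma\in L(\sigma,N)$, where $v$ runs over the valuations of $R$ which are nonnegative on $R$. The *local positive tropicalization* $\mathrm{ptrop}(I)$ is the closure, in $\overline\sigma^\circ$, of the set of all $v\circ\gamma$, where $v$ runs over the valuations of $R$ which are nonnegative on $R$ and positive precisely on the maximal ideal of $R$. (If $I=K[[\Gamma]]$, there are no valuations and both sets are empty.) For a face $\tau$ of $\sigma$ put $\Gamma_\tau=\Gamma\cap\tau^\perp$; the $\tau$-truncation of $f=\sum_{m\in\Gamma}a_m\chi^m$ is $f_\tau=\sum_{m\in\Gamma_\tau}a_m\chi^m\in K[[\Gamma_\tau]]$. Each $w\in L(\sigma,N)$ lies in the stratum $(N/N_\tau)_{\mathbb R}$ of exactly one face $\tau$ of $\sigma$ (where $N_\tau$ is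 the sublattice of $N$ spanned by $\tau\cap N$), namely the face such that $w$ is finite exactly on $\check\sigma\cap M\cap\tau^\perp$. For $w\in\overline\sigma$ in the stratum of $\tau$, the $w$-initial form $\mathrm{in}_w(f)$ of $f\in K[[\Gamma]]$ is the sum of those terms $a_m\chi^m$ of $f_\tau$ with $a_m\neq0$ for which $w(m)$ is minimal ($\mathrm{in}_w(f)=0$ if $f_\tau=0$), and the initial ideal $\mathrm{in}_w(I)$ is the ideal of $K[[\Gamma_\tau]]$ generated by the initial forms $\mathrm{in}_w(f)$, $f\in I$. It is *monomial free* if it contains no $\chi^m$ with $m\in\Gamma_\tau$. **Theorem.** For every ideal $I$ of $K[[\Gamma]]$: (i) $\mathrm{ptrop}(I)=\mathrm{nntrop}(I)\cap\overline\sigma^\circ$; (ii) $\mathrm{nntrop}(I)=\{\,w\in\overline\sigma \;:\; \mathrm{in}_w(I)\text{ is monomial free}\,\}$. -/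

import Mathlib

open Algebra Topology
open scoped TensorProduct

noncomputable section

namespace LocalTrop

universe u v

/-! ### Formal toric rings `K[[Γ]]` -/

/-- Every element of `Γ` can be written in only finitely many ways as a sum of two elements.  This
is what makes the convolution product of formal series with exponents in `Γ` meaningful; it holds
for every pointed affine semigroup (see the instance below) and for its submonoids. -/
class FiniteDecompositions (Γ : Type u) [AddCommMonoid Γ] : Prop where
  finite_decompositions : ∀ m : Γ, {p : Γ × Γ | p.1 + p.2 = m}.Finite

instance instFiniteDecompositionsSubmonoid {Γ : Type u} [AddCommMonoid Γ]
    [FiniteDecompositions Γ] (S : AddSubmonoid Γ) : FiniteDecompositions S where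
  finite_decompositions m := by
    refine Set.Finite.of_injOn (f := fun p : S × S => ((p.1 : Γ), (p.2 : Γ)))
      ?_ ?_ (FiniteDecompositions.finite_decompositions (m : Γ))
    · intro p hp
      have h : p.1 + p.2 = m := hp
      change (p.1 : Γ) + (p.2 : Γ) = m
      rw [← h]; rfl
    · rintro ⟨a, b⟩ - ⟨c, d⟩ - h
      simp only [Prod.mk.injEq, Subtype.ext_iff] at h ⊢
      exact h

/-- A finitely generated cancellative semigroup whose only invertible element is `0` has finite
decompositions. -/
instance instFiniteDecompositionsPointed {Γ : Type u} [AddCancelCommMonoid Γ] [AddMonoid.FG Γ]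
    [Subsingleton (AddUnits Γ)] : FiniteDecompositions Γ where
  finite_decompositions m := by
    classical
    have hpos : ∀ a b : Γ, a + b = 0 → a = 0 := fun a b h => by
      have := congrArg AddUnits.val
        (Subsingleton.elim (⟨a, b, h, by rw [add_comm, h]⟩ : AddUnits Γ) 0)
      simpa using this
    obtain ⟨s, hs⟩ := AddMonoid.FG.fg_top (M := Γ)
    let t : Finset Γ := s.erase 0
    let φ : (t → ℕ) → Γ := fun c => ∑ i, c i • (i : Γ)
    have hφadd : ∀ c d, φ (c + d) = φ c + φ d := fun c d => by
      simp [φ, add_smul, Finset.sum_add_distrib]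
    have hsum : ∀ (A : Finset t) (f : t → Γ), ∑ i ∈ A, f i = 0 → ∀ i ∈ A, f i = 0 := by
      intro A f
      induction A using Finset.induction_on with
      | empty => simp
      | insert a A ha ih =>
        intro h i hi
        rw [Finset.sum_insert ha] at h
        have h1 := hpos _ _ h
        rw [h1, zero_add] at h
        rcases Finset.mem_insert.1 hi with rfl | hi
        · exact h1
        · exact ih h i hi
    have hsmul : ∀ (n : ℕ) (a : Γ), n • a = 0 → n = 0 ∨ a = 0 := by
      intro n a h
      cases n with
      | zero => exact Or.inl rfl
      | succ n =>
        rw [succ_nsmul, add_comm] at h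
        exact Or.inr (hpos _ _ h)
    have hφzero : ∀ c, φ c = 0 → c = 0 := by
      intro c h
      funext i
      rcases hsmul _ _ (hsum _ _ h i (Finset.mem_univ i)) with h | h
      · exact h
      · exact absurd h (Finset.ne_of_mem_erase i.2)
    have hsurj : Function.Surjective φ := by
      intro a
      have ha : a ∈ AddSubmonoid.closure (s : Set Γ) := by rw [hs]; trivial
      induction ha using AddSubmonoid.closure_induction with
      | mem x hx =>
        by_cases hx0 : x = 0
        · exact ⟨0, by simp [φ, hx0]⟩
        · refine ⟨Pi.single ⟨x, Finset.mem_erase.2 ⟨hx0, hx⟩⟩ 1, ?_⟩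
          simp only [φ]
          rw [Finset.sum_eq_single ⟨x, Finset.mem_erase.2 ⟨hx0, hx⟩⟩]
          · simp
          · intro b _ hb
            simp [hb]
          · simp
      | zero => exact ⟨0, by simp [φ]⟩
      | add x y _ _ hx hy =>
        obtain ⟨c, rfl⟩ := hx
        obtain ⟨d, rfl⟩ := hy
        exact ⟨c + d, hφadd c d⟩
    have hfib : {c | φ c = m}.Finite := by
      by_contra hinf
      have hanti : IsAntichain (· ≤ ·) {c | φ c = m} := by
        intro c hc d hd hne hle
        apply hne
        obtain ⟨e, rfl⟩ := exists_add_of_le hle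
        have h1 : φ c = m := hc
        have h2 : φ (c + e) = m := hd
        rw [hφadd, h1] at h2
        have h3 : φ e = 0 := by simpa using h2
        simp [hφzero e h3]
      exact hinf (WellQuasiOrderedLE.finite_of_isAntichain hanti)
    refine ((hfib.biUnion fun c _ =>
      (Set.finite_Iic c).prod (Set.finite_Iic c)).image fun p => (φ p.1, φ p.2)).subset ?_
    rintro ⟨a, b⟩ hab
    obtain ⟨c, rfl⟩ := hsurj a
    obtain ⟨d, rfl⟩ := hsurj b
    refine ⟨(c, d), ?_, rfl⟩
    have h : φ c + φ d = m := hab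
    simp only [Set.mem_iUnion]
    refine ⟨c + d, by rw [← h]; exact hφadd c d, ?_⟩
    exact ⟨fun i => Nat.le_add_right (c i) (d i), fun i => Nat.le_add_left (d i) (c i)⟩

/-- The set `K[[Γ]]` of formal sums `∑ aₘ χᵐ`, `m ∈ Γ`, `aₘ ∈ K`, given by their coefficients. -/
def FormalToricRing (K : Type v) (Γ : Type u) : Type (max u v) := Γ → K

namespace FormalToricRing

variable {K : Type v} {Γ : Type u}

/-- The coefficient of `χᵐ` in a formal series. -/
def coeff (m : Γ) (f : FormalToricRing K Γ) : K := f m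

/-- The formal series with the given coefficients. -/
def mk (a : Γ → K) : FormalToricRing K Γ := a

@[simp] theorem coeff_mk (m : Γ) (a : Γ → K) : coeff m (mk a) = a m := rfl

@[ext] theorem ext {f g : FormalToricRing K Γ} (h : ∀ m, coeff m f = coeff m g) : f = g :=
  funext h

instance instAddCommGroup [CommRing K] : AddCommGroup (FormalToricRing K Γ) :=
  inferInstanceAs (AddCommGroup (Γ → K))

@[simp] theorem coeff_add [CommRing K] (m : Γ) (f g : FormalToricRing K Γ) :
    coeff m (f + g) = coeff m f + coeff m g := rfl

@[simp] theorem coeff_zero [CommRing K] (m : Γ) : coeff m (0 : FormalToricRing K Γ) = 0 := rfl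

open Classical in
/-- The monomial `χᵐ`. -/
def monomial [CommRing K] (m : Γ) : FormalToricRing K Γ := mk fun n => if n = m then 1 else 0

open Classical in
theorem coeff_monomial [CommRing K] (m n : Γ) :
    coeff n (monomial m : FormalToricRing K Γ) = if n = m then 1 else 0 := rfl

section Ring

variable [CommRing K] [AddCommMonoid Γ] [FiniteDecompositions Γ]

/-- The finite set of pairs `(p, q)` with `p + q = m`. -/
def decompositions (m : Γ) : Finset (Γ × Γ) :=
  (FiniteDecompositions.finite_decompositions m).toFinset

@[simp] theorem mem_decompositions {m : Γ} {p : Γ × Γ} :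
    p ∈ decompositions m ↔ p.1 + p.2 = m := by
  simp [decompositions]

instance instOne : One (FormalToricRing K Γ) := ⟨monomial 0⟩

instance instMul : Mul (FormalToricRing K Γ) :=
  ⟨fun f g => mk fun m => ∑ p ∈ decompositions m, coeff p.1 f * coeff p.2 g⟩

theorem coeff_mul (m : Γ) (f g : FormalToricRing K Γ) :
    coeff m (f * g) = ∑ p ∈ decompositions m, coeff p.1 f * coeff p.2 g := rfl

protected theorem mul_comm (f g : FormalToricRing K Γ) : f * g = g * f := by
  ext m
  rw [coeff_mul, coeff_mul]
  refine Finset.sum_nbij' Prod.swap Prod.swap ?_ ?_ ?_ ?_ ?_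
  · intro p hp; rw [mem_decompositions] at hp ⊢; rw [← hp]; exact add_comm _ _
  · intro p hp; rw [mem_decompositions] at hp ⊢; rw [← hp]; exact add_comm _ _
  · intro p _; rfl
  · intro p _; rfl
  · intro p _; exact mul_comm _ _

protected theorem one_mul (f : FormalToricRing K Γ) : 1 * f = f := by
  classical
  ext m
  rw [coeff_mul, Finset.sum_eq_single (0, m)]
  · change coeff 0 (monomial 0) * _ = _
    simp [coeff_monomial]
  · rintro ⟨a, b⟩ hp hne
    rw [mem_decompositions] at hp
    change coeff a (monomial 0) * _ = _
    rw [coeff_monomial, if_neg, zero_mul]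
    rintro rfl
    exact hne (by simpa using hp)
  · simp

protected theorem mul_assoc (f g h : FormalToricRing K Γ) : f * g * h = f * (g * h) := by
  ext m
  simp only [coeff_mul, Finset.sum_mul, Finset.mul_sum, Finset.sum_sigma']
  refine Finset.sum_nbij' (fun x => ⟨(x.2.1, x.2.2 + x.1.2), (x.2.2, x.1.2)⟩)
    (fun x => ⟨(x.1.1 + x.2.1, x.2.2), (x.1.1, x.2.1)⟩) ?_ ?_ ?_ ?_ ?_
  · rintro ⟨⟨i, j⟩, ⟨k, l⟩⟩ hx
    simp only [Finset.mem_sigma, mem_decompositions] at hx ⊢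
    exact ⟨by rw [← add_assoc, hx.2, hx.1], trivial⟩
  · rintro ⟨⟨i, j⟩, ⟨k, l⟩⟩ hx
    simp only [Finset.mem_sigma, mem_decompositions] at hx ⊢
    exact ⟨by rw [add_assoc, hx.2, hx.1], trivial⟩
  · rintro ⟨⟨i, j⟩, ⟨k, l⟩⟩ hx
    simp only [Finset.mem_sigma, mem_decompositions] at hx
    obtain ⟨-, rfl⟩ := hx
    rfl
  · rintro ⟨⟨i, j⟩, ⟨k, l⟩⟩ hx
    simp only [Finset.mem_sigma, mem_decompositions] at hx
    obtain ⟨-, rfl⟩ := hx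
    rfl
  · rintro ⟨⟨i, j⟩, ⟨k, l⟩⟩ _
    exact mul_assoc _ _ _

protected theorem add_mul (f g h : FormalToricRing K Γ) : (f + g) * h = f * h + g * h := by
  ext m
  simp only [coeff_mul, coeff_add, add_mul, Finset.sum_add_distrib]

protected theorem zero_mul (f : FormalToricRing K Γ) : 0 * f = 0 := by
  ext m
  simp [coeff_mul]

/-- `K[[Γ]]` is a commutative ring under the convolution product. -/
instance instCommRing : CommRing (FormalToricRing K Γ) where
  __ := instAddCommGroup
  one := 1
  mul := (· * ·)
  mul_assoc := FormalToricRing.mul_assoc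
  one_mul := FormalToricRing.one_mul
  mul_one f := by rw [FormalToricRing.mul_comm, FormalToricRing.one_mul]
  mul_comm := FormalToricRing.mul_comm
  zero_mul := FormalToricRing.zero_mul
  mul_zero f := by rw [FormalToricRing.mul_comm, FormalToricRing.zero_mul]
  right_distrib := FormalToricRing.add_mul
  left_distrib f g h := by
    rw [FormalToricRing.mul_comm, FormalToricRing.add_mul, FormalToricRing.mul_comm g,
      FormalToricRing.mul_comm h]

theorem monomial_mul_monomial (m n : Γ) :
    (monomial m * monomial n : FormalToricRing K Γ) = monomial (m + n) := by
  classical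
  ext k
  rw [coeff_mul, coeff_monomial]
  by_cases hk : k = m + n
  · rw [if_pos hk, Finset.sum_eq_single (m, n)]
    · simp [coeff_monomial]
    · rintro ⟨a, b⟩ _ hne
      by_cases ha : a = m
      · have hb : b ≠ n := fun hb => hne (by rw [ha, hb])
        simp [coeff_monomial, hb]
      · simp [coeff_monomial, ha]
    · intro h
      exact absurd (mem_decompositions.2 hk.symm) h
  · rw [if_neg hk]
    refine Finset.sum_eq_zero ?_
    rintro ⟨a, b⟩ hp
    rw [mem_decompositions] at hp
    by_cases ha : a = m
    · have hb : b ≠ n := fun hb => hk (by rw [← hp, ha, hb])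
      simp [coeff_monomial, hb]
    · simp [coeff_monomial, ha]

variable (K Γ) in
/-- The natural semigroup morphism `(Γ, +) → (K[[Γ]], ·)`, `m ↦ χᵐ`. -/
def monomialHom : Multiplicative Γ →* FormalToricRing K Γ where
  toFun m := monomial m.toAdd
  map_one' := rfl
  map_mul' m n := (monomial_mul_monomial m.toAdd n.toAdd).symm

end Ring

end FormalToricRing

/-! ### The cones of an affine semigroup and the extended cone -/

section Cones

variable (Γ : Type u) [AddCommMonoid Γ]

/-- The real vector space `M(Γ)_ℝ`, where `M(Γ)` is the group generated by the differences of
elements of `Γ`. -/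
abbrev MReal : Type u := ℝ ⊗[ℤ] GrothendieckAddGroup Γ

/-- The real vector space `N(Γ)_ℝ`, seen as the dual of `M(Γ)_ℝ`. -/
abbrev NReal : Type u := Module.Dual ℝ (MReal Γ)

variable {Γ} in
/-- The image in `M(Γ)_ℝ` of an element of `Γ`. -/
def toMReal (m : Γ) : MReal Γ := (1 : ℝ) ⊗ₜ[ℤ] GrothendieckAddGroup.of m

/-- The cone `σ̌(Γ) ⊆ M(Γ)_ℝ` generated by `Γ`. -/
def dualCone : PointedCone ℝ (MReal Γ) :=
  PointedCone.hull ℝ (Set.range (toMReal : Γ → MReal Γ))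

/-- The cone `σ(Γ) ⊆ N(Γ)_ℝ` of the linear forms which are nonnegative on `σ̌(Γ)`. -/
def cone : PointedCone ℝ (NReal Γ) :=
  PointedCone.dual (Module.Dual.eval ℝ (MReal Γ)) (dualCone Γ : Set (MReal Γ))

/-- The semigroup `σ̌ ∩ M`, for `σ̌ = σ̌(Γ)` and `M = M(Γ)`. -/
def latticePoints : AddSubmonoid (GrothendieckAddGroup Γ) where
  carrier := {m | (1 : ℝ) ⊗ₜ[ℤ] m ∈ dualCone Γ}
  zero_mem' := by
    change (1 : ℝ) ⊗ₜ[ℤ] (0 : GrothendieckAddGroup Γ) ∈ dualCone Γ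
    rw [TensorProduct.tmul_zero]
    exact zero_mem _
  add_mem' {a b} ha hb := by
    change (1 : ℝ) ⊗ₜ[ℤ] (a + b) ∈ dualCone Γ
    rw [TensorProduct.tmul_add]
    exact add_mem ha hb

variable {Γ} in
/-- The natural map `Γ → σ̌ ∩ M`. -/
def toLatticePoints (m : Γ) : latticePoints Γ :=
  ⟨GrothendieckAddGroup.of m, Submodule.subset_span ⟨m, rfl⟩⟩

/-- The affine linear variety `L(σ, N)`: the semigroup morphisms from `σ̌ ∩ M` to `ℝ ∪ {+∞}`. -/
def LinearVariety : Type u := latticePoints Γ →+ WithTop ℝ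

instance instFunLikeLinearVariety : FunLike (LinearVariety Γ) (latticePoints Γ) (WithTop ℝ) :=
  inferInstanceAs (FunLike (latticePoints Γ →+ WithTop ℝ) (latticePoints Γ) (WithTop ℝ))

/-- `L(σ, N)` carries the topology of pointwise convergence. -/
instance instTopologicalSpaceLinearVariety : TopologicalSpace (LinearVariety Γ) :=
  TopologicalSpace.induced (fun w => (w : latticePoints Γ → WithTop ℝ)) inferInstance

/-- The extended cone `σ̄ ⊆ L(σ, N)`: the morphisms with values in `[0, +∞]`. -/
def extendedCone : Set (LinearVariety Γ) := {w | ∀ m, 0 ≤ w m}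

/-- The interior `σ̄°` of the extended cone: the elements of `σ̄` which take positive values
(possibly `+∞`) on the non-invertible elements of `σ̌ ∩ M`. -/
def extendedConeInterior : Set (LinearVariety Γ) :=
  {w | w ∈ extendedCone Γ ∧ ∀ m, ¬ IsAddUnit m → 0 < w m}

variable {Γ}

/-- The stratum `(N/N_τ)_ℝ` of `L(σ, N)` attached to a face `τ` of `σ`: the morphisms which are
finite on `τ^⊥ ∩ σ̌ ∩ M` and equal to `+∞` on the rest of `σ̌ ∩ M`. -/
def stratum (τ : PointedCone ℝ (NReal Γ)) : Set (LinearVariety Γ) :=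
  {w | ∀ m : latticePoints Γ,
    w m ≠ ⊤ ↔ ∀ u ∈ τ, u ((1 : ℝ) ⊗ₜ[ℤ] (m : GrothendieckAddGroup Γ)) = 0}

/-- The subsemigroup `Γ_τ = Γ ∩ τ^⊥` of `Γ`. -/
def truncSubmonoid (τ : PointedCone ℝ (NReal Γ)) : AddSubmonoid Γ where
  carrier := {m | ∀ u ∈ τ, u (toMReal m) = 0}
  zero_mem' := by
    intro u _
    rw [toMReal, map_zero, TensorProduct.tmul_zero, map_zero]
  add_mem' {a b} ha hb := by
    intro u hu
    rw [toMReal, map_add, TensorProduct.tmul_add, map_add]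
    have h1 := ha u hu
    have h2 := hb u hu
    rw [toMReal] at h1 h2
    rw [h1, h2, add_zero]

end Cones

/-! ### Initial forms and initial ideals -/

section Initial

open FormalToricRing

variable {K : Type v} {Γ : Type u} [CommRing K]

open Classical in
/-- The initial form of a series `f` with respect to weights `w` on its exponents: the sum of the
terms `aₘ χᵐ` of `f` for which `w m` is the minimum of `w` on the exponents of `f`. -/
def initForm {Λ : Type u} (w : Λ → WithTop ℝ) (f : FormalToricRing K Λ) : FormalToricRing K Λ :=
  mk fun m => if ∀ n, coeff n f ≠ 0 → w m ≤ w n then coeff m f else 0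

variable [AddCommMonoid Γ]

/-- The `τ`-truncation of a series, an element of `K[[Γ_τ]]`. -/
def truncation (τ : PointedCone ℝ (NReal Γ)) (f : FormalToricRing K Γ) :
    FormalToricRing K (truncSubmonoid τ) :=
  mk fun m => coeff (m : Γ) f

/-- The weights on the exponents of `Γ_τ` given by an element of `L(σ, N)`. -/
def weight (τ : PointedCone ℝ (NReal Γ)) (w : LinearVariety Γ) (m : truncSubmonoid τ) :
    WithTop ℝ :=
  w (toLatticePoints (m : Γ))

variable [FiniteDecompositions Γ]

/-- For `w` in the stratum of `L(σ, N)` attached to the face `τ`, the initial ideal `in_w(I)`: the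
ideal of `K[[Γ_τ]]` generated by the `w`-initial forms of the `τ`-truncations of the elements of
`I`. -/
def initialIdeal (τ : PointedCone ℝ (NReal Γ)) (w : LinearVariety Γ)
    (I : Ideal (FormalToricRing K Γ)) : Ideal (FormalToricRing K (truncSubmonoid τ)) :=
  Ideal.span {g | ∃ f ∈ I, g = initForm (weight τ w) (truncation τ f)}

/-- An ideal of a formal toric ring is monomial free if it contains no monomial `χᵐ`. -/
def MonomialFree (J : Ideal (FormalToricRing K Γ)) : Prop := ∀ m : Γ, monomial m ∉ J

/-- The set of the `w` in the extended cone for which `in_w(I)` is monomial free; here `τ` is the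
face of `σ` such that `w` lies in the stratum attached to `τ`. -/
def monomialFreeLocus (I : Ideal (FormalToricRing K Γ)) : Set (LinearVariety Γ) :=
  {w | w ∈ extendedCone Γ ∧ ∃ τ : PointedCone ℝ (NReal Γ),
    τ.IsFaceOf (cone Γ) ∧ w ∈ stratum τ ∧ MonomialFree (initialIdeal τ w I)}

end Initial

/-! ### Valuations and local tropicalization -/

section Trop

/-- The valuations of `R`, with values in `ℝ ∪ {+∞}`, which are nonnegative on `R`. -/
def nonnegValuations (R : Type v) [CommRing R] : Set (AddValuation R (WithTop ℝ)) :=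
  {v | ∀ f, 0 ≤ v f}

/-- The local valuations of a local ring `R`: those which are nonnegative on `R` and positive
precisely on the maximal ideal, that is, on the non-units.  (There are none for the zero ring.) -/
def localValuations (R : Type v) [CommRing R] : Set (AddValuation R (WithTop ℝ)) :=
  {v | v ∈ nonnegValuations R ∧ {f | 0 < v f} = nonunits R}

variable {Γ : Type u} [AddCommMonoid Γ] {R : Type v} [CommRing R]

/-- The image in `L(σ, N)` of a set `W` of valuations of `R` under `v ↦ v ∘ γ`.  The morphism
`v ∘ γ` from `Γ` to `ℝ ∪ {+∞}` is seen as an element of `L(σ, N)` through its unique extension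
to `σ̌ ∩ M`. -/
def tropImage (γ : Multiplicative Γ →* R) (W : Set (AddValuation R (WithTop ℝ))) :
    Set (LinearVariety Γ) :=
  {w | ∃ v ∈ W, ∀ m : Γ, w (toLatticePoints m) = v (γ (Multiplicative.ofAdd m))}

/-- The local nonnegative tropicalization of `γ`. -/
def nntrop (γ : Multiplicative Γ →* R) : Set (LinearVariety Γ) :=
  tropImage γ (nonnegValuations R)

/-- The local positive tropicalization of `γ`: the closure, in the interior of the extended cone,
of the image of the local valuations. -/
def ptrop (γ : Multiplicative Γ →* R) : Set (LinearVariety Γ) :=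
  closure (tropImage γ (localValuations R)) ∩ extendedConeInterior Γ

variable {K : Type v} [CommRing K] [FiniteDecompositions Γ]

/-- The natural semigroup morphism `Γ → K[[Γ]]/I`. -/
def quotientHom (I : Ideal (FormalToricRing K Γ)) :
    Multiplicative Γ →* FormalToricRing K Γ ⧸ I :=
  (Ideal.Quotient.mk I).toMonoidHom.comp (FormalToricRing.monomialHom K Γ)

/-- The local nonnegative tropicalization of an ideal of `K[[Γ]]`. -/
def nntropIdeal (I : Ideal (FormalToricRing K Γ)) : Set (LinearVariety Γ) :=
  nntrop (quotientHom I)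

/-- The local positive tropicalization of an ideal of `K[[Γ]]`. -/
def ptropIdeal (I : Ideal (FormalToricRing K Γ)) : Set (LinearVariety Γ) :=
  ptrop (quotientHom I)

end Trop

end LocalTrop

end

/-! Valuations are studied through the seminorms exp(-v), which are multiplicative, nonarchimedean
and bounded by 1. Such seminorms form a closed subset of a product of copies of [0, 1], so limits
along ultrafilters exist. Hence the closure of the image of any set of nonnegative valuations stays
in the nonnegative tropicalization (`closure_tropImage_subset`), which gives one inclusion of (i).
For the other, a nonnegative valuation whose image is interior is already local, because every
nonunit of the quotient is represented by a series without constant term.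

Valuations are not assumed continuous, so their values on infinite sums need an argument. By
Dickson's lemma, a series whose exponents are exponents of monomials of an ideal lies in that ideal
(`mem_ideal_of_support`); hence termwise bounds on valuations extend to series.

For (ii), let w come from v. If g is an initial form of f ∈ I, of weight c, then f - g has only
terms of weight > c and v(f) = ∞, so v(g) > c. The series each of whose homogeneous components has
valuation exceeding its weight form an ideal (`exceedingIdeal`). It contains in_w(I), but no
monomial of finite weight c, since such a monomial has valuation exactly c.

Conversely, let μ be the quotient modulo I of the weighted maximum seminorm. If μ(χ^m) were smaller
than exp(-w(m)) for some m ∈ Γ_τ, then χ^m would be congruent modulo I to a series with all weights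
> w(m), and χ^m would be an initial form of I. So monomial freeness makes μ multiplicative and
nonzero on these monomials. A minimal power-multiplicative seminorm below μ with the same values on
them is multiplicative (`exists_multiplicative_seminorm_le`), and its negative logarithm is the
required valuation. -/

noncomputable section

namespace LocalTrop

universe u v

/-! ### Passage between additive and multiplicative values. -/

section ExpNeg

/-- The order-reversing map `x ↦ exp (-x)` from `ℝ ∪ {+∞}` to `ℝ`, with value `0` at `+∞`. -/
def expNeg : WithTop ℝ → ℝ
  | ⊤ => 0
  | (x : ℝ) => Real.exp (-x)

/-- The map `x ↦ -log x` from `[0, +∞)` to `ℝ ∪ {+∞}`, with value `+∞` at `0`. -/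
def negLog (x : ℝ) : WithTop ℝ := if x = 0 then ⊤ else ((-Real.log x : ℝ) : WithTop ℝ)

@[simp] theorem expNeg_top : expNeg ⊤ = 0 := rfl

@[simp] theorem expNeg_coe (x : ℝ) : expNeg (x : WithTop ℝ) = Real.exp (-x) := rfl

@[simp] theorem expNeg_zero : expNeg 0 = 1 := by
  rw [← WithTop.coe_zero, expNeg_coe, neg_zero, Real.exp_zero]

theorem expNeg_nonneg (x : WithTop ℝ) : 0 ≤ expNeg x := by
  cases x with
  | top => exact le_rfl
  | coe x => exact (Real.exp_pos _).le

theorem expNeg_add (x y : WithTop ℝ) : expNeg (x + y) = expNeg x * expNeg y := by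
  cases x with
  | top => simp
  | coe x =>
    cases y with
    | top => simp
    | coe y =>
      rw [← WithTop.coe_add, expNeg_coe, expNeg_coe, expNeg_coe, ← Real.exp_add]
      congr 1; ring

theorem expNeg_strictAnti : StrictAnti expNeg := by
  intro x y h
  cases x with
  | top => exact absurd h not_top_lt
  | coe x =>
    cases y with
    | top => exact Real.exp_pos _
    | coe y =>
      rw [expNeg_coe, expNeg_coe, Real.exp_lt_exp]
      exact neg_lt_neg (WithTop.coe_lt_coe.1 h)

theorem expNeg_injective : Function.Injective expNeg := expNeg_strictAnti.injective

theorem expNeg_ne_zero {x : WithTop ℝ} (hx : x ≠ ⊤) : expNeg x ≠ 0 := fun h =>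
  hx (expNeg_injective (h.trans expNeg_top.symm))

theorem expNeg_le_one {x : WithTop ℝ} (hx : 0 ≤ x) : expNeg x ≤ 1 := by
  simpa using expNeg_strictAnti.antitone hx

theorem expNeg_negLog {x : ℝ} (hx : 0 ≤ x) : expNeg (negLog x) = x := by
  unfold negLog
  split_ifs with h
  · simp [h]
  · rw [expNeg_coe, neg_neg, Real.exp_log (hx.lt_of_ne' h)]

/-- A monotone surjection between order topologies is continuous; the dual of the nonnegative reals
is the target because the map reverses order and has image [0, ∞). -/
theorem continuous_expNeg : Continuous expNeg := by
  let e : WithTop ℝ → (NNReal)ᵒᵈ := fun x => OrderDual.toDual ⟨expNeg x, expNeg_nonneg x⟩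
  have hmono : Monotone e := fun x y h => expNeg_strictAnti.antitone h
  have hsurj : Function.Surjective e := fun y =>
    ⟨negLog (OrderDual.ofDual y : NNReal), congrArg OrderDual.toDual
      (Subtype.ext (expNeg_negLog (OrderDual.ofDual y).2))⟩
  have := hmono.continuous_of_surjective hsurj
  exact NNReal.continuous_coe.comp (continuous_ofDual.comp this)

end ExpNeg

/-! ### Limits of valuations and construction of multiplicative seminorms. -/

section MultiplicativeSeminorm

variable {R : Type v} [CommRing R]

/-- The additive valuation `-log f` attached to a multiplicative nonarchimedean seminorm `f`. -/
def valuationOfSeminorm (f : R → ℝ) (hnn : ∀ x, 0 ≤ f x) (h0 : f 0 = 0) (h1 : f 1 = 1)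
    (hmul : ∀ x y, f (x * y) = f x * f y) (hna : IsNonarchimedean f) :
    AddValuation R (WithTop ℝ) :=
  AddValuation.of (fun x => negLog (f x))
    (by simp [h0, negLog]) (by simp [h1, negLog])
    (by
      intro x y
      rw [← expNeg_strictAnti.le_iff_ge, expNeg_strictAnti.antitone.map_min,
        expNeg_negLog (hnn _), expNeg_negLog (hnn _), expNeg_negLog (hnn _)]
      exact hna x y)
    (by
      intro x y
      apply expNeg_injective
      rw [expNeg_add, expNeg_negLog (hnn _), expNeg_negLog (hnn _), expNeg_negLog (hnn _), hmul])

theorem expNeg_valuationOfSeminorm {f : R → ℝ} (hnn : ∀ x, 0 ≤ f x) (h0 : f 0 = 0) (h1 : f 1 = 1)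
    (hmul : ∀ x y, f (x * y) = f x * f y) (hna : IsNonarchimedean f) (x : R) :
    expNeg (valuationOfSeminorm f hnn h0 h1 hmul hna x) = f x :=
  expNeg_negLog (hnn x)

theorem valuationOfSeminorm_nonneg {f : R → ℝ} (hnn : ∀ x, 0 ≤ f x) (h0 : f 0 = 0) (h1 : f 1 = 1)
    (hmul : ∀ x y, f (x * y) = f x * f y) (hna : IsNonarchimedean f) (hle : ∀ x, f x ≤ 1) :
    valuationOfSeminorm f hnn h0 h1 hmul hna ∈ nonnegValuations R := by
  intro x
  rw [← expNeg_strictAnti.le_iff_ge, expNeg_valuationOfSeminorm, expNeg_zero]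
  exact hle x

/-- A limit along an ultrafilter of nonnegative valuations is a nonnegative valuation. -/
theorem exists_nonnegValuation_tendsto {X : Type*} (U : Ultrafilter X)
    (v : X → AddValuation R (WithTop ℝ)) (hv : ∀ x, v x ∈ nonnegValuations R) :
    ∃ v₀ ∈ nonnegValuations R, ∀ r, Filter.Tendsto (fun x => expNeg (v x r)) U
      (𝓝 (expNeg (v₀ r))) := by
  have hlim : ∀ r, ∃ a ∈ Set.Icc (0 : ℝ) 1,
      Filter.Tendsto (fun x => expNeg (v x r)) U (𝓝 a) := by
    intro r
    have := (isCompact_Icc (a := (0 : ℝ)) (b := 1)).ultrafilter_le_nhds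
      (U.map fun x => expNeg (v x r)) (by
        rw [Filter.le_principal_iff]
        exact Filter.mem_map.2 <| Filter.Eventually.of_forall fun x : X =>
          Set.mem_Icc.2 ⟨expNeg_nonneg _, expNeg_le_one (hv x r)⟩)
    exact this
  choose f hf hlim using hlim
  have hf0 : ∀ r, 0 ≤ f r := fun r => (Set.mem_Icc.1 (hf r)).1
  have hf1 : ∀ r, f r ≤ 1 := fun r => (Set.mem_Icc.1 (hf r)).2
  have heq : ∀ {a b : ℝ} {g : X → ℝ}, Filter.Tendsto g U (𝓝 a) → Filter.Tendsto g U (𝓝 b) →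
      a = b := fun h h' => tendsto_nhds_unique h h'
  have hmap0 : f 0 = 0 := heq (hlim 0) (tendsto_const_nhds.congr fun x => by
    rw [AddValuation.map_zero, expNeg_top])
  have hmap1 : f 1 = 1 := heq (hlim 1) (tendsto_const_nhds.congr fun x => by
    rw [AddValuation.map_one, expNeg_zero])
  have hmul : ∀ x y, f (x * y) = f x * f y := fun x y =>
    heq (hlim _) (((hlim x).mul (hlim y)).congr fun z => by
      rw [AddValuation.map_mul, expNeg_add])
  have hna : IsNonarchimedean f := by
    intro x y
    refine le_of_tendsto_of_tendsto' (hlim _) ((hlim x).max (hlim y)) fun z => ?_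
    rw [← expNeg_strictAnti.antitone.map_min]
    exact expNeg_strictAnti.antitone ((v z).map_add x y)
  refine ⟨valuationOfSeminorm f hf0
    hmap0 hmap1 hmul hna, valuationOfSeminorm_nonneg _ _ _ _ _ hf1, fun r => ?_⟩
  rw [expNeg_valuationOfSeminorm]
  exact hlim r

/-- The infimum of a nonempty chain of power-multiplicative nonarchimedean seminorms. -/
theorem exists_seminorm_iInf_of_chain (c : Set (RingSeminorm R)) (hne : c.Nonempty)
    (hc : IsChain (fun f g : RingSeminorm R => ∀ x, f x ≤ g x) c)
    (hna : ∀ f ∈ c, IsNonarchimedean f) (hpm : ∀ f ∈ c, IsPowMul f) :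
    ∃ g : RingSeminorm R, IsNonarchimedean g ∧ IsPowMul g ∧ (∀ f ∈ c, ∀ x, g x ≤ f x) ∧
      ∀ x a, (∀ f ∈ c, f x = a) → g x = a := by
  have : Nonempty c := hne.to_subtype
  have hbdd : ∀ x, BddBelow (Set.range fun f : c => (f : RingSeminorm R) x) := fun x =>
    ⟨0, by rintro _ ⟨f, rfl⟩; exact apply_nonneg _ _⟩
  let p : R → ℝ := fun x => ⨅ f : c, (f : RingSeminorm R) x
  have hple : ∀ (f : c) x, p x ≤ (f : RingSeminorm R) x := fun f x => ciInf_le (hbdd x) f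
  have hp0 : ∀ x, 0 ≤ p x := fun x => le_ciInf fun f => apply_nonneg _ _
  have hlt : ∀ x a, p x < a → ∃ f : c, (f : RingSeminorm R) x < a := fun x a h =>
    exists_lt_of_ciInf_lt h
  -- The chain condition supplies a single member close to the infimum at both x and y; a pointwise
  -- infimum without it need not be a seminorm.
  have hlt2 : ∀ x y a b, p x < a → p y < b → ∃ f : c, (f : RingSeminorm R) x < a ∧
      (f : RingSeminorm R) y < b := by
    intro x y a b ha hb
    obtain ⟨f, hf⟩ := hlt x a ha
    obtain ⟨g, hg⟩ := hlt y b hb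
    rcases eq_or_ne f g with rfl | hfg
    · exact ⟨f, hf, hg⟩
    rcases hc f.2 g.2 (fun h => hfg (Subtype.ext h)) with h | h
    · exact ⟨f, hf, (h y).trans_lt hg⟩
    · exact ⟨g, (h x).trans_lt hf, hg⟩
  have hconst : ∀ x a, (∀ f ∈ c, f x = a) → p x = a := by
    intro x a h
    have : (fun f : c => (f : RingSeminorm R) x) = fun _ => a := funext fun f => h f f.2
    simp only [p, this, ciInf_const]
  have hpna : IsNonarchimedean p := by
    intro x y
    refine le_of_forall_gt_imp_ge_of_dense fun a ha => ?_
    obtain ⟨f, h1, h2⟩ := hlt2 x y a a ((le_max_left _ _).trans_lt ha)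
      ((le_max_right _ _).trans_lt ha)
    exact (hple f _).trans ((hna f f.2 x y).trans (max_le h1.le h2.le))
  let g : RingSeminorm R :=
    { toFun := p
      map_zero' := hconst 0 0 fun f _ => map_zero f
      add_le' := fun x y => (hpna x y).trans (max_le_add_of_nonneg (hp0 x) (hp0 y))
      neg' := fun x => by simp only [p, map_neg_eq_map]
      mul_le' := fun x y => by
        have key : ∀ ε > 0, p (x * y) ≤ (p x + ε) * (p y + ε) := by
          intro ε hε
          obtain ⟨f, h1, h2⟩ := hlt2 x y (p x + ε) (p y + ε) (by linarith) (by linarith)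
          exact (hple f _).trans ((map_mul_le_mul f.1 x y).trans
            (mul_le_mul h1.le h2.le (apply_nonneg _ _) (by linarith [hp0 x])))
        have ht : Filter.Tendsto (fun ε : ℝ => (p x + ε) * (p y + ε)) (𝓝[>] 0)
            (𝓝 ((p x + 0) * (p y + 0))) :=
          ((Continuous.tendsto (by fun_prop) 0)).mono_left nhdsWithin_le_nhds
        rw [add_zero, add_zero] at ht
        exact ge_of_tendsto ht (Filter.eventually_of_mem self_mem_nhdsWithin key) }
  refine ⟨g, hpna, ?_, fun f hf x => hple ⟨f, hf⟩ x, hconst⟩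
  intro x n hn
  change p (x ^ n) = p x ^ n
  have hcont : Filter.Tendsto (fun ε : ℝ => (p x + ε) ^ n) (𝓝[>] 0) (𝓝 ((p x + 0) ^ n)) :=
    ((Continuous.tendsto (by fun_prop) 0)).mono_left nhdsWithin_le_nhds
  rw [add_zero] at hcont
  refine le_antisymm (ge_of_tendsto hcont (Filter.eventually_of_mem self_mem_nhdsWithin ?_))
    (le_ciInf fun f => ?_)
  · intro ε hε
    have hε : 0 < ε := hε
    obtain ⟨f, h1⟩ := hlt x (p x + ε) (by linarith)
    refine (hple f _).trans ?_
    rw [hpm f f.2 x hn]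
    exact pow_le_pow_left₀ (apply_nonneg _ _) h1.le n
  · rw [hpm f f.2 x hn]
    exact pow_le_pow_left₀ (hp0 x) (hple f x) n

/-- A nonarchimedean seminorm `μ` which is multiplicative and nonzero on a submonoid `S` dominates
a multiplicative nonarchimedean seminorm which agrees with `μ` on `S`. -/
theorem exists_multiplicative_seminorm_le (μ : RingSeminorm R) (hna : IsNonarchimedean μ)
    (S : Submonoid R) (h1 : μ 1 = 1) (hS : ∀ s ∈ S, μ s ≠ 0)
    (hmul : ∀ s ∈ S, ∀ t ∈ S, μ (s * t) = μ s * μ t) :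
    ∃ f : RingSeminorm R, IsNonarchimedean f ∧ (∀ x y, f (x * y) = f x * f y) ∧
      (∀ x, f x ≤ μ x) ∧ ∀ s ∈ S, f s = μ s := by
  let P : Set (RingSeminorm R) :=
    {f | IsNonarchimedean f ∧ IsPowMul f ∧ (∀ x, f x ≤ μ x) ∧ ∀ s ∈ S, f s = μ s}
  have hμpow : ∀ s ∈ S, ∀ n : ℕ, 1 ≤ n → μ (s ^ n) = μ s ^ n := by
    intro s hs n hn
    induction n, hn using Nat.le_induction with
    | base => simp
    | succ n _ ih => rw [pow_succ, hmul _ (pow_mem hs n) _ hs, ih, pow_succ]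
  -- Smoothing, the limit of μ(x^n)^(1/n), yields power-multiplicativity and changes nothing on S,
  -- where μ already respects powers.
  have hstart : smoothingSeminorm μ h1.le hna ∈ P :=
    ⟨isNonarchimedean_smoothingFun μ h1.le hna, isPowMul_smoothingFun μ h1.le,
      smoothingFun_le_self μ, fun s hs => smoothingFun_of_powMul μ h1.le (hμpow s hs)⟩
  obtain ⟨f, hf⟩ : ∃ f, f ∈ P ∧ ∀ g ∈ P, (∀ x, g x ≤ f x) → ∀ x, g x = f x := by
    -- The order is reversed, so that Zorn's lemma produces a minimal seminorm.
    let r : P → P → Prop := fun f g => ∀ x, g.1 x ≤ f.1 x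
    obtain ⟨m, hm⟩ := exists_maximal_of_chains_bounded (r := r) (fun C hC => by
        rcases C.eq_empty_or_nonempty with rfl | hne
        · exact ⟨⟨_, hstart⟩, fun a ha => absurd ha (Set.notMem_empty a)⟩
        · obtain ⟨g, hg1, hg2, hg3, hg4⟩ := exists_seminorm_iInf_of_chain (Subtype.val '' C)
            (hne.image _) (by
              rintro _ ⟨a, ha, rfl⟩ _ ⟨b, hb, rfl⟩ hab
              exact (hC ha hb fun h => hab (congrArg _ h)).symm)
            (by rintro _ ⟨a, -, rfl⟩; exact a.2.1) (by rintro _ ⟨a, -, rfl⟩; exact a.2.2.1)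
          obtain ⟨a, ha⟩ := hne
          refine ⟨⟨g, hg1, hg2, fun x => (hg3 _ ⟨a, ha, rfl⟩ x).trans (a.2.2.2.1 x),
            fun s hs => hg4 s _ ?_⟩, fun b hb => hg3 _ ⟨b, hb, rfl⟩⟩
          rintro _ ⟨b, -, rfl⟩
          exact b.2.2.2.2 s hs)
      (fun {a b c} h h' x => (h' x).trans (h x))
    exact ⟨m.1, m.2, fun g hg h x => le_antisymm (h x) (hm ⟨g, hg⟩ h x)⟩
  obtain ⟨⟨hfna, hfpm, hfle, hfS⟩, hmin⟩ := hf
  have hf1 : f 1 ≤ 1 := (hfle 1).trans h1.le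
  -- The seminorm lim f(y s^n) / f(s)^n lies below f and is multiplicative against s. On S the
  -- sequence is constant, so the limit stays in P and equals f by minimality.
  have hSmul : ∀ s ∈ S, ∀ y, f (s * y) = f s * f y := by
    intro s hs
    have hs0 : f s ≠ 0 := by rw [hfS s hs]; exact hS s hs
    have hg := hmin (seminormFromConst hf1 hs0 hfpm)
      ⟨seminormFromConst_isNonarchimedean hf1 hs0 hfpm hfna,
        seminormFromConst_isPowMul hf1 hs0 hfpm,
        fun x => (seminormFromConst_le_seminorm hf1 hs0 hfpm x).trans (hfle x), fun t ht => by
          refine tendsto_nhds_unique (tendsto_seminormFromConst_seq_atTop hf1 hs0 hfpm t) ?_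
          refine tendsto_const_nhds.congr fun n => ?_
          have hsn : μ (s ^ n) = μ s ^ n := by
            cases n with
            | zero => simp [h1]
            | succ n => exact hμpow s hs _ (Nat.succ_pos n)
          rw [seminormFromConst_seq, hfS _ (mul_mem ht (pow_mem hs n)), hfS s hs,
            hmul t ht _ (pow_mem hs n), hsn, mul_div_cancel_right₀ _ (pow_ne_zero _ (hS s hs))]⟩
      (seminormFromConst_le_seminorm hf1 hs0 hfpm)
    intro y
    have := seminormFromConst_const_mul hf1 hs0 hfpm y
    simp only [← seminormFromConst_def hf1 hs0 hfpm, hg] at this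
    exact this
  refine ⟨f, hfna, fun x => ?_, hfle, hfS⟩
  by_cases hx : f x = 0
  · intro y
    rw [hx, zero_mul]
    refine le_antisymm ((map_mul_le_mul f x y).trans ?_) (apply_nonneg _ _)
    rw [hx, zero_mul]
  -- The same construction now works for any x with f x ≠ 0: elements of S are multiplicative
  -- against everything by `hSmul`, so their values are again preserved.
  have hg := hmin (seminormFromConst hf1 hx hfpm)
    ⟨seminormFromConst_isNonarchimedean hf1 hx hfpm hfna,
      seminormFromConst_isPowMul hf1 hx hfpm,
      fun y => (seminormFromConst_le_seminorm hf1 hx hfpm y).trans (hfle y), fun t ht => by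
        rw [← hfS t ht]
        exact seminormFromConst_apply_of_isMul hf1 hx hfpm (hSmul t ht)⟩
    (seminormFromConst_le_seminorm hf1 hx hfpm)
  intro y
  have := seminormFromConst_const_mul hf1 hx hfpm y
  simp only [← seminormFromConst_def hf1 hx hfpm, hg] at this
  exact this

end MultiplicativeSeminorm

/-! ### Integral relations, faces of the cone and strata. -/

section Cones

/-- Finitely many real numbers can be replaced by integers of the same signs by an additive map. -/
theorem exists_addMonoidHom_rat_sign (s : Finset ℝ) :
    ∃ φ : ℝ →+ ℚ, ∀ a ∈ s, 0 < a → 0 < φ a := by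
  classical
  let b := Module.Basis.ofVectorSpace ℚ ℝ
  -- `L q a` is the real number obtained from a when the Hamel basis is replaced by q. Positivity on
  -- finitely many a is an open condition on q, satisfied by the basis itself, hence by some
  -- rational q.
  let L : (Module.Basis.ofVectorSpaceIndex ℚ ℝ → ℝ) → ℝ → ℝ := fun q a =>
    ∑ j ∈ (b.repr a).support, (b.repr a j : ℝ) * q j
  let P : Set (Module.Basis.ofVectorSpaceIndex ℚ ℝ → ℝ) := {q | ∀ a ∈ s, 0 < a → 0 < L q a}
  have hP : IsOpen P := by
    have : P = ⋂ a ∈ s, ⋂ _ : 0 < a, {q | 0 < L q a} := by ext; simp [P]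
    rw [this]
    refine isOpen_biInter_finset fun a _ => isOpen_iInter_of_finite fun _ => ?_
    exact isOpen_lt continuous_const (by fun_prop)
  have hne : P.Nonempty := by
    refine ⟨fun j => b j, fun a _ ha => ?_⟩
    have h : L (fun j => b j) a = a := by
      conv_rhs => rw [← b.linearCombination_repr a]
      simp [L, Finsupp.linearCombination_apply, Finsupp.sum, Rat.smul_def]
    rwa [h]
  have hd : DenseRange (Pi.map fun (_ : Module.Basis.ofVectorSpaceIndex ℚ ℝ) (x : ℚ) => (x : ℝ)) :=
    DenseRange.piMap fun _ => Rat.denseRange_cast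
  obtain ⟨q, hq⟩ := hd.exists_mem_open hP hne
  refine ⟨(b.constr ℚ q).toAddMonoidHom, fun a ha h0 => ?_⟩
  have h := hq a ha h0
  have e : ((b.constr ℚ q a : ℚ) : ℝ) = L (Pi.map (fun _ (x : ℚ) => (x : ℝ)) q) a := by
    simp [L, Module.Basis.constr_apply, Finsupp.sum]
  change 0 < b.constr ℚ q a
  rw [← e] at h
  exact_mod_cast h

/-- A linear relation with real coefficients in `ℝ ⊗ M` yields a relation in `M` with integer
coefficients of the same signs. -/
theorem exists_int_relation {M ι : Type*} [AddCommGroup M] (s : Finset ι) (a : ι → ℝ)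
    (m : ι → M) (h : ∑ i ∈ s, a i ⊗ₜ[ℤ] m i = 0) :
    ∃ n : ι → ℤ, ∑ i ∈ s, n i • m i = 0 ∧ ∀ i ∈ s, (0 < a i → 0 < n i) ∧ (a i < 0 → n i < 0) ∧
      (a i = 0 → n i = 0) := by
  classical
  -- The opposites are included because φ is controlled only on positive numbers.
  obtain ⟨φ, hφ⟩ := exists_addMonoidHom_rat_sign (s.image a ∪ s.image fun i => -a i)
  let d : ℕ := ∏ i ∈ s, (φ (a i)).den
  have hd : 0 < d := Finset.prod_pos fun i _ => (φ (a i)).den_pos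
  have hz : ∀ i ∈ s, ∃ z : ℤ, (z : ℚ) = d * φ (a i) := by
    intro i hi
    obtain ⟨k, hk⟩ : (φ (a i)).den ∣ d := Finset.dvd_prod_of_mem _ hi
    refine ⟨k * (φ (a i)).num, ?_⟩
    rw [hk]
    push_cast
    rw [mul_comm ((φ (a i)).den : ℚ) k, mul_assoc, mul_comm ((φ (a i)).den : ℚ), Rat.mul_den_eq_num]
  choose! z hz using hz
  have hrel : (1 : ℚ) ⊗ₜ[ℤ] (∑ i ∈ s, z i • m i) = 0 := by
    have h1 : (d : ℤ) • TensorProduct.map φ.toIntLinearMap (LinearMap.id (R := ℤ) (M := M))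
        (∑ i ∈ s, a i ⊗ₜ[ℤ] m i) = 0 := by rw [h, map_zero, smul_zero]
    simp only [map_sum, TensorProduct.map_tmul, Finset.smul_sum] at h1
    rw [TensorProduct.tmul_sum, ← h1]
    refine Finset.sum_congr rfl fun i hi => ?_
    rw [TensorProduct.tmul_smul, TensorProduct.smul_tmul', TensorProduct.smul_tmul']
    congr 1
    simp [hz i hi]
  obtain ⟨c, hc⟩ := (IsLocalizedModule.eq_zero_iff (nonZeroDivisors ℤ)
    (TensorProduct.mk ℤ ℚ M 1)).1 hrel
  have hc0 : (c : ℤ) ≠ 0 := nonZeroDivisors.coe_ne_zero c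
  -- The integer c kills the torsion left after clearing denominators; its square is used since c
  -- may be negative and signs must survive.
  have hc2 : 0 < (c : ℤ) * c := mul_self_pos.2 hc0
  have hdq : (0 : ℚ) < d := by exact_mod_cast hd
  refine ⟨fun i => (c : ℤ) * c * z i, ?_, fun i hi => ⟨fun ha => ?_, fun ha => ?_, fun ha => ?_⟩⟩
  · simp only [mul_smul, ← Finset.smul_sum]
    have : (c : ℤ) • ∑ i ∈ s, z i • m i = 0 := hc
    rw [this, smul_zero]
  · refine mul_pos hc2 ?_
    have := mul_pos hdq (hφ (a i) (by
      simp only [Finset.mem_union, Finset.mem_image]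
      exact .inl ⟨i, hi, rfl⟩) ha)
    rw [← hz i hi] at this
    exact_mod_cast this
  · refine mul_neg_of_pos_of_neg hc2 ?_
    have := mul_pos hdq (hφ (-a i) (by
      simp only [Finset.mem_union, Finset.mem_image]
      exact .inr ⟨i, hi, rfl⟩) (neg_pos.2 ha))
    rw [map_neg, mul_neg, ← hz i hi, neg_pos] at this
    exact_mod_cast this
  · have := hz i hi
    rw [ha, map_zero, mul_zero] at this
    have hz0 : z i = 0 := by exact_mod_cast this
    simp only [hz0, mul_zero]

/-- Gordan's alternative: finitely many vectors with no nontrivial nonnegative linear relation lie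
in an open half space. -/
theorem exists_dual_pos {E : Type*} [AddCommGroup E] [Module ℝ E] [Module.Finite ℝ E]
    (s : Finset E)
    (h : ∀ a : E → ℝ, (∀ y ∈ s, 0 ≤ a y) → ∑ y ∈ s, a y • y = 0 → ∀ y ∈ s, a y = 0) :
    ∃ u : Module.Dual ℝ E, ∀ y ∈ s, 0 < u y := by
  let e := (Module.finBasis ℝ E).equivFun
  let C : Set (Fin (Module.finrank ℝ E) → ℝ) := convexHull ℝ (e.toLinearMap '' (s : Set E))
  have hC : IsCompact C := (s.finite_toSet.image _).isCompact_convexHull ℝ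
  -- Convex weights representing 0 would all vanish by hypothesis, yet sum to 1. A hyperplane
  -- strictly separating 0 from the hull gives u.
  have h0 : (0 : Fin (Module.finrank ℝ E) → ℝ) ∉ C := by
    intro h0
    simp only [C] at h0
    rw [← LinearMap.image_convexHull] at h0
    obtain ⟨y, hy, hy0⟩ := h0
    obtain rfl : y = 0 := e.map_eq_zero_iff.1 hy0
    obtain ⟨a, ha, ha1, ha0⟩ := Finset.mem_convexHull'.1 hy
    rw [Finset.sum_eq_zero (h a ha ha0)] at ha1
    exact zero_ne_one ha1
  obtain ⟨f, t, hf0, hf⟩ := geometric_hahn_banach_point_closed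
    (convex_convexHull ℝ (e.toLinearMap '' (s : Set E))) hC.isClosed h0
  refine ⟨f.toLinearMap ∘ₗ e.toLinearMap, fun y hy => ?_⟩
  rw [map_zero] at hf0
  exact hf0.trans (hf _ (subset_convexHull ℝ (e.toLinearMap '' (s : Set E)) ⟨y, hy, rfl⟩))

section FG

variable {Γ : Type u} [AddCancelCommMonoid Γ]

theorem grothendieckAddGroup_of_injective :
    Function.Injective (GrothendieckAddGroup.of : Γ →+ GrothendieckAddGroup Γ) := by
  intro a b h
  obtain ⟨c, hc⟩ := (AddLocalization.addMonoidOf (⊤ : AddSubmonoid Γ)).exists_of_eq h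
  exact add_left_cancel hc

/-- Every element of `σ̌ ∩ M` has a positive multiple in `Γ`. -/
theorem exists_nsmul_eq_toLatticePoints (m : latticePoints Γ) :
    ∃ k : ℕ, 0 < k ∧ ∃ g : Γ, k • m = toLatticePoints g := by
  classical
  obtain ⟨c, hc⟩ := Finsupp.mem_span_range_iff_exists_finsupp.1 m.2
  -- The index `none` stands for m with coefficient -1; its integral replacement is negative and
  -- supplies the multiple k.
  let a : Option Γ → ℝ := fun o => o.elim (-1) fun g => (c g : ℝ)
  let x : Option Γ → GrothendieckAddGroup Γ := fun o =>
    o.elim (m : GrothendieckAddGroup Γ) GrothendieckAddGroup.of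
  have hrel : ∑ o ∈ c.support.insertNone, a o ⊗ₜ[ℤ] x o = 0 := by
    rw [Finset.sum_insertNone]
    have : ∑ g ∈ c.support, a (some g) ⊗ₜ[ℤ] x (some g) =
        (1 : ℝ) ⊗ₜ[ℤ] (m : GrothendieckAddGroup Γ) := by
      rw [← hc, Finsupp.sum]
      refine Finset.sum_congr rfl fun g _ => ?_
      change (c g : ℝ) ⊗ₜ[ℤ] GrothendieckAddGroup.of g = (c g : ℝ) • toMReal g
      rw [toMReal, TensorProduct.smul_tmul', smul_eq_mul, mul_one]
    rw [this]
    change (-1 : ℝ) ⊗ₜ[ℤ] (m : GrothendieckAddGroup Γ) + _ = 0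
    rw [← TensorProduct.add_tmul, neg_add_cancel, TensorProduct.zero_tmul]
  obtain ⟨n, hn, hsign⟩ := exists_int_relation _ a x hrel
  have h0 : n none < 0 := (hsign none (by simp)).2.1 (by simp [a])
  have hpos : ∀ g ∈ c.support, 0 ≤ n (some g) := by
    intro g hg
    have h := hsign (some g) (by simpa using hg)
    rcases (c g).2.eq_or_lt with h' | h'
    · exact (h.2.2 h'.symm).ge
    · exact (h.1 h').le
  refine ⟨(-n none).toNat, by omega, ∑ g ∈ c.support, (n (some g)).toNat • g, ?_⟩
  apply Subtype.ext
  change (-n none).toNat • (m : GrothendieckAddGroup Γ) = GrothendieckAddGroup.of _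
  rw [Finset.sum_insertNone] at hn
  rw [map_sum, ← natCast_zsmul, Int.toNat_of_nonneg (by omega), neg_smul, neg_eq_iff_add_eq_zero]
  refine Eq.trans (congrArg₂ (· + ·) rfl ?_) hn
  refine Finset.sum_congr rfl fun g hg => ?_
  rw [map_nsmul, ← natCast_zsmul, Int.toNat_of_nonneg (hpos g hg)]
  rfl

theorem toLatticePoints_add (a b : Γ) :
    toLatticePoints (a + b) = toLatticePoints a + toLatticePoints b :=
  Subtype.ext (map_add GrothendieckAddGroup.of a b)

theorem toLatticePoints_zero : toLatticePoints (0 : Γ) = 0 :=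
  Subtype.ext (map_zero GrothendieckAddGroup.of)

theorem toLatticePoints_nsmul (k : ℕ) (a : Γ) :
    toLatticePoints (k • a) = k • toLatticePoints a :=
  Subtype.ext (map_nsmul GrothendieckAddGroup.of k a)

theorem toLatticePoints_injective :
    Function.Injective (toLatticePoints : Γ → latticePoints Γ) := fun _ _ h =>
  grothendieckAddGroup_of_injective (congrArg Subtype.val h)

theorem eq_zero_of_add_eq_zero [Subsingleton (AddUnits Γ)] {a b : Γ} (h : a + b = 0) : a = 0 := by
  have := congrArg AddUnits.val
    (Subsingleton.elim (⟨a, b, h, by rw [add_comm, h]⟩ : AddUnits Γ) 0)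
  simpa using this

/-- An inverse b of m in the saturation has a multiple k • b = g in Γ, so k • m + g = 0 in Γ, and
pointedness forces m = 0. -/
theorem not_isAddUnit_toLatticePoints [Subsingleton (AddUnits Γ)] {m : Γ} (hm : m ≠ 0) :
    ¬ IsAddUnit (toLatticePoints m) := by
  rintro ⟨⟨a, b, hab, _⟩, h⟩
  obtain ⟨k, hk, g, hg⟩ := exists_nsmul_eq_toLatticePoints b
  have h1 : toLatticePoints (k • m + g) = toLatticePoints 0 := by
    rw [toLatticePoints_add, toLatticePoints_nsmul, ← hg, ← smul_add, ← h, toLatticePoints_zero]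
    exact (congrArg (k • ·) hab).trans (smul_zero k)
  have h2 := eq_zero_of_add_eq_zero (toLatticePoints_injective h1)
  obtain ⟨j, rfl⟩ : ∃ j, k = j + 1 := ⟨k - 1, by omega⟩
  rw [succ_nsmul, add_comm] at h2
  exact hm (eq_zero_of_add_eq_zero h2)

/-- The complement of a prime ideal of `Γ` is cut out by an element of the cone `σ`. -/
theorem exists_mem_cone_face [AddMonoid.FG Γ] (F : AddSubmonoid Γ)
    (hF : ∀ a b, a + b ∈ F → a ∈ F) :
    ∃ u ∈ cone Γ, (∀ m ∈ F, u (toMReal m) = 0) ∧ ∀ m ∉ F, 0 < u (toMReal m) := by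
  classical
  obtain ⟨S, hS⟩ := AddMonoid.FG.fg_top (M := Γ)
  have : Module.Finite ℤ (GrothendieckAddGroup Γ) := Module.Finite.iff_addGroup_fg.2
    (AddGroup.fg_iff_addMonoid_fg.2 inferInstance)
  -- A form on the quotient by V vanishes on F automatically; Gordan's alternative makes it positive
  -- on the images of the generators outside F.
  let V : Submodule ℝ (MReal Γ) := Submodule.span ℝ (Set.range fun f : F => toMReal (f : Γ))
  let p : Γ → MReal Γ ⧸ V := fun m => V.mkQ (toMReal m)
  let T : Finset (MReal Γ ⧸ V) := (S.filter (· ∉ F)).image p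
  have hT : ∀ y ∈ T, ∃ m : Γ, m ∉ F ∧ p m = y := by
    intro y hy
    obtain ⟨m, hm, rfl⟩ := Finset.mem_image.1 hy
    exact ⟨m, (Finset.mem_filter.1 hm).2, rfl⟩
  choose! g hgF hg using hT
  obtain ⟨u, hu⟩ := exists_dual_pos T (by
    intro a ha hsum
    have hmem : ∑ y ∈ T, a y • toMReal (g y) ∈ V := by
      rw [← Submodule.Quotient.mk_eq_zero, ← V.mkQ_apply, map_sum, ← hsum]
      refine Finset.sum_congr rfl fun y hy => ?_
      rw [map_smul]
      exact congrArg _ (hg y hy)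
    obtain ⟨c, hc⟩ := Finsupp.mem_span_range_iff_exists_finsupp.1 hmem
    let b : (MReal Γ ⧸ V) ⊕ F → ℝ := Sum.elim a fun f => - c f
    let x : (MReal Γ ⧸ V) ⊕ F → Γ := Sum.elim g fun f => f
    obtain ⟨n, hn, hsign⟩ := exists_int_relation (T.disjSum c.support) b
      (fun i => GrothendieckAddGroup.of (x i)) (by
        rw [Finset.sum_disjSum]
        have h1 : ∑ y ∈ T, b (.inl y) ⊗ₜ[ℤ] GrothendieckAddGroup.of (x (.inl y)) =
            ∑ y ∈ T, a y • toMReal (g y) := Finset.sum_congr rfl fun y _ => by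
          rw [toMReal, TensorProduct.smul_tmul', smul_eq_mul, mul_one]; rfl
        have h2 : ∑ f ∈ c.support, b (.inr f) ⊗ₜ[ℤ] GrothendieckAddGroup.of (x (.inr f)) =
            - ∑ y ∈ T, a y • toMReal (g y) := by
          rw [← hc, Finsupp.sum, ← Finset.sum_neg_distrib]
          refine Finset.sum_congr rfl fun f _ => ?_
          rw [toMReal, ← neg_smul, TensorProduct.smul_tmul', smul_eq_mul, mul_one]; rfl
        rw [h1, h2, add_neg_cancel])
    intro y hy
    by_contra hne
    have hpos : 0 < n (.inl y) :=
      (hsign _ (by simpa using hy)).1 ((ha y hy).lt_of_ne' hne)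
    have hnn : ∀ y ∈ T, 0 ≤ n (.inl y) := by
      intro y hy
      rcases (ha y hy).eq_or_lt with h' | h'
      · exact ((hsign (.inl y) (by simpa using hy)).2.2 h'.symm).ge
      · exact ((hsign (.inl y) (by simpa using hy)).1 h').le
    -- Moving the negative coefficients to the right gives an identity in Γ whose right side lies in
    -- F. Since summands of elements of F are in F, some `g y` would lie in F.
    have hrel : ∑ y ∈ T, (n (.inl y)).toNat • g y +
        ∑ f ∈ c.support, (n (.inr f)).toNat • (f : Γ) =
        ∑ f ∈ c.support, (-n (.inr f)).toNat • (f : Γ) := by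
      apply grothendieckAddGroup_of_injective
      rw [map_add, map_sum, map_sum, map_sum, ← sub_eq_zero, add_sub_assoc,
        ← Finset.sum_sub_distrib, ← hn, Finset.sum_disjSum]
      congr 1
      · refine Finset.sum_congr rfl fun y hy => ?_
        rw [map_nsmul, ← natCast_zsmul, Int.toNat_of_nonneg (hnn y hy)]
        rfl
      · refine Finset.sum_congr rfl fun f _ => ?_
        rw [map_nsmul, map_nsmul, ← natCast_zsmul, ← natCast_zsmul, ← sub_smul]
        congr 1
        omega
    have hmem2 : ∑ y ∈ T, (n (.inl y)).toNat • g y ∈ F :=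
      hF _ _ (hrel ▸ sum_mem fun (f : F) _ => nsmul_mem f.2 _)
    rw [← Finset.add_sum_erase _ _ hy] at hmem2
    have hmem3 := hF _ _ hmem2
    obtain ⟨k, hk⟩ : ∃ k, (n (.inl y)).toNat = k + 1 := ⟨(n (.inl y)).toNat - 1, by omega⟩
    rw [hk, succ_nsmul, add_comm] at hmem3
    exact hgF y hy (hF _ _ hmem3))
  have hzero : ∀ m ∈ F, (u ∘ₗ V.mkQ) (toMReal m) = 0 := by
    intro m hm
    have : V.mkQ (toMReal m) = 0 := by
      rw [← LinearMap.mem_ker, V.ker_mkQ]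
      exact Submodule.subset_span ⟨⟨m, hm⟩, rfl⟩
    rw [LinearMap.comp_apply, this, map_zero]
  have hdich : ∀ m : Γ, m ∈ F ∨ 0 < (u ∘ₗ V.mkQ) (toMReal m) := by
    intro m
    have hm : m ∈ AddSubmonoid.closure (S : Set Γ) := by rw [hS]; trivial
    induction hm using AddSubmonoid.closure_induction with
    | mem x hx =>
      by_cases h : x ∈ F
      · exact .inl h
      · exact .inr (hu _ (Finset.mem_image.2 ⟨x, Finset.mem_filter.2 ⟨hx, h⟩, rfl⟩))
    | zero => exact .inl F.zero_mem
    | add x y _ _ hx hy =>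
      have hadd : (u ∘ₗ V.mkQ) (toMReal (x + y)) =
          (u ∘ₗ V.mkQ) (toMReal x) + (u ∘ₗ V.mkQ) (toMReal y) := by
        rw [← map_add, toMReal, map_add, TensorProduct.tmul_add]; rfl
      rw [hadd]
      rcases hx with hx | hx <;> rcases hy with hy | hy
      · exact .inl (add_mem hx hy)
      · rw [hzero x hx, zero_add]; exact .inr hy
      · rw [hzero y hy, add_zero]; exact .inr hx
      · exact .inr (add_pos hx hy)
  refine ⟨u ∘ₗ V.mkQ, ?_, hzero, fun m hm => (hdich m).resolve_left hm⟩
  rw [cone, dualCone, PointedCone.dual_hull]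
  rintro _ ⟨m, rfl⟩
  rcases hdich m with h | h
  · exact (hzero m h).ge
  · exact h.le

theorem linearVariety_map_add (w : LinearVariety Γ) (a b : latticePoints Γ) :
    w (a + b) = w a + w b := map_add (show latticePoints Γ →+ WithTop ℝ from w) a b

theorem linearVariety_map_zero (w : LinearVariety Γ) : w 0 = 0 :=
  map_zero (show latticePoints Γ →+ WithTop ℝ from w)

theorem linearVariety_map_nsmul (w : LinearVariety Γ) (k : ℕ) (a : latticePoints Γ) :
    w (k • a) = k • w a := map_nsmul (show latticePoints Γ →+ WithTop ℝ from w) k a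

theorem map_nsmul_ne_top_iff (w : LinearVariety Γ) {k : ℕ} (hk : 0 < k) (m : latticePoints Γ) :
    w (k • m) ≠ ⊤ ↔ w m ≠ ⊤ := by
  rw [linearVariety_map_nsmul]
  obtain ⟨j, rfl⟩ : ∃ j, k = j + 1 := ⟨k - 1, by omega⟩
  cases w m with
  | top => simp [succ_nsmul]
  | coe x => simp only [← WithTop.coe_nsmul, ne_eq, WithTop.coe_ne_top, not_false_eq_true]

/-- Every element of `L(σ, N)` lies in the stratum of a face of `σ`. -/
theorem exists_isFaceOf_mem_stratum [AddMonoid.FG Γ] (w : LinearVariety Γ) :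
    ∃ τ : PointedCone ℝ (NReal Γ), τ.IsFaceOf (cone Γ) ∧ w ∈ stratum τ := by
  let F : AddSubmonoid Γ :=
    { carrier := {m | w (toLatticePoints m) ≠ ⊤}
      zero_mem' := by
        simp [toLatticePoints_zero, linearVariety_map_zero]
      add_mem' := by
        intro a b ha hb
        change w _ ≠ ⊤
        rw [toLatticePoints_add, linearVariety_map_add]
        exact WithTop.add_ne_top.2 ⟨ha, hb⟩ }
  obtain ⟨u, hu, huF, hupos⟩ := exists_mem_cone_face F (fun a b h => by
    change w _ ≠ ⊤ at h
    rw [toLatticePoints_add, linearVariety_map_add, WithTop.add_ne_top] at h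
    exact h.1)
  -- The face is σ ∩ F^⊥, where F is the finiteness locus of w. The form u belongs to it and is
  -- positive off F, so Γ ∩ τ^⊥ is exactly F.
  let τ : PointedCone ℝ (NReal Γ) :=
    { carrier := {x | x ∈ cone Γ ∧ ∀ m ∈ F, x (toMReal m) = 0}
      zero_mem' := ⟨zero_mem _, fun _ _ => rfl⟩
      add_mem' := fun {x y} hx hy => ⟨add_mem hx.1 hy.1, fun m hm => by
        rw [LinearMap.add_apply, hx.2 m hm, hy.2 m hm, add_zero]⟩
      smul_mem' := fun r x hx => ⟨Submodule.smul_mem _ r hx.1, fun m hm => by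
        rw [← Nonneg.coe_smul, LinearMap.smul_apply, hx.2 m hm, smul_zero]⟩ }
  have hnn : ∀ x ∈ cone Γ, ∀ m : Γ, 0 ≤ x (toMReal m) := fun x hx m =>
    hx (Submodule.subset_span ⟨m, rfl⟩)
  refine ⟨τ, ⟨fun x hx => hx.1, fun {x y a} hx hy ha h => ⟨hx, fun m hm => ?_⟩⟩, fun m => ?_⟩
  · have h1 := h.2 m hm
    rw [LinearMap.add_apply, LinearMap.smul_apply, smul_eq_mul] at h1
    have h2 := hnn x hx m
    have h3 := hnn y hy m
    nlinarith [mul_nonneg ha.le h2]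
  · obtain ⟨k, hk, g, hg⟩ := exists_nsmul_eq_toLatticePoints m
    have hval : ∀ x : NReal Γ, x ((1 : ℝ) ⊗ₜ[ℤ] (m : GrothendieckAddGroup Γ)) = 0 ↔
        x (toMReal g) = 0 := by
      intro x
      have : toMReal g = k • ((1 : ℝ) ⊗ₜ[ℤ] (m : GrothendieckAddGroup Γ)) := by
        rw [← TensorProduct.tmul_smul]
        exact congrArg (fun y : latticePoints Γ => (1 : ℝ) ⊗ₜ[ℤ] (y : GrothendieckAddGroup Γ))
          hg.symm
      rw [this, map_nsmul, smul_eq_zero_iff_right hk.ne']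
    rw [← map_nsmul_ne_top_iff w hk, hg]
    simp only [hval]
    refine ⟨fun h x hx => hx.2 g h, fun h => ?_⟩
    by_contra hgF
    exact (hupos g (not_not_intro hgF)).ne' (h u ⟨hu, huF⟩)

theorem mem_truncSubmonoid_iff {w : LinearVariety Γ} {τ : PointedCone ℝ (NReal Γ)}
    (hw : w ∈ stratum τ) (m : Γ) : m ∈ truncSubmonoid τ ↔ w (toLatticePoints m) ≠ ⊤ :=
  (hw (toLatticePoints m)).symm

theorem mem_extendedCone_iff (w : LinearVariety Γ) :
    w ∈ extendedCone Γ ↔ ∀ m : Γ, 0 ≤ w (toLatticePoints m) := by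
  refine ⟨fun h m => h _, fun h m => ?_⟩
  obtain ⟨k, hk, g, hg⟩ := exists_nsmul_eq_toLatticePoints m
  have h1 := h g
  rw [← hg, linearVariety_map_nsmul] at h1
  cases hx : w m with
  | top => exact le_top
  | coe x =>
    rw [hx, ← WithTop.coe_nsmul, ← WithTop.coe_zero, WithTop.coe_le_coe, nsmul_eq_mul] at h1
    rw [← WithTop.coe_zero, WithTop.coe_le_coe]
    exact nonneg_of_mul_nonneg_right h1 (by exact_mod_cast hk)

end FG

end Cones

open FormalToricRing

/-! ### Dickson's lemma and ideals of formal series. -/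

section Series

variable {K : Type v} {Γ : Type u}

theorem exists_fin_surjective (Γ : Type u) [AddCommMonoid Γ] [AddMonoid.FG Γ] :
    ∃ (n : ℕ) (φ : (Fin n → ℕ) →+ Γ), Function.Surjective φ := by
  have : Module.Finite ℕ Γ := Module.Finite.iff_addMonoid_fg.2 inferInstance
  obtain ⟨n, f, hf⟩ := Module.Finite.exists_fin' ℕ Γ
  exact ⟨n, f.toAddMonoidHom, hf⟩

/-- Dickson's lemma for a finitely generated semigroup. -/
theorem exists_finset_generating [AddCommMonoid Γ] [AddMonoid.FG Γ] (U : Set Γ) :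
    ∃ T : Finset Γ, (∀ t ∈ T, t ∈ U) ∧ ∀ m ∈ U, ∃ t ∈ T, ∃ n, m = t + n := by
  classical
  obtain ⟨n, φ, hφ⟩ := exists_fin_surjective Γ
  let P : (Fin n → ℕ) → Prop := fun c => φ c ∈ U
  have hanti : IsAntichain (· ≤ ·) {c | Minimal P c} := by
    intro c hc d hd hne hle
    exact hne (le_antisymm hle (hd.2 hc.1 hle))
  have hfin : {c | Minimal P c}.Finite := WellQuasiOrderedLE.finite_of_isAntichain hanti
  refine ⟨hfin.toFinset.image φ, ?_, ?_⟩
  · intro t ht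
    obtain ⟨c, hc, rfl⟩ := Finset.mem_image.1 ht
    exact ((hfin.mem_toFinset).1 hc).1
  · intro m hm
    obtain ⟨c, rfl⟩ := hφ m
    obtain ⟨d, hdc, hd⟩ := exists_minimal_le_of_wellFoundedLT P c hm
    obtain ⟨e, rfl⟩ := exists_add_of_le hdc
    exact ⟨φ d, Finset.mem_image.2 ⟨d, (hfin.mem_toFinset).2 hd, rfl⟩, φ e, map_add φ d e⟩

/-- The finite values of a nonnegative weight on a finitely generated semigroup are well ordered. -/
theorem isPWO_weights [AddCommMonoid Γ] [AddMonoid.FG Γ] (ω : Γ →+ WithTop ℝ)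
    (hω : ∀ m, 0 ≤ ω m) : {x : ℝ | ∃ m, ω m = x}.IsPWO := by
  obtain ⟨n, φ, hφ⟩ := exists_fin_surjective Γ
  intro f
  choose m hm using fun i => (f i).2
  choose c hc using fun i => hφ (m i)
  obtain ⟨i, j, hij, hle⟩ := wellQuasiOrdered_le c
  refine ⟨i, j, hij, ?_⟩
  obtain ⟨e, he⟩ := exists_add_of_le hle
  have h : ω (m i) ≤ ω (m j) := by
    rw [← hc i, ← hc j, he, map_add, map_add]
    exact le_add_of_nonneg_right (hω _)
  rw [hm, hm] at h
  exact WithTop.coe_le_coe.1 h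

@[simp] theorem coeff_sub [CommRing K] (m : Γ) (f g : FormalToricRing K Γ) :
    coeff m (f - g) = coeff m f - coeff m g := rfl

@[simp] theorem coeff_neg [CommRing K] (m : Γ) (f : FormalToricRing K Γ) :
    coeff m (-f) = - coeff m f := rfl

theorem coeff_sum [CommRing K] {ι : Type*} (m : Γ) (s : Finset ι) (f : ι → FormalToricRing K Γ) :
    coeff m (∑ i ∈ s, f i) = ∑ i ∈ s, coeff m (f i) := by
  classical
  induction s using Finset.induction_on with
  | empty => rfl
  | insert a s ha ih => rw [Finset.sum_insert ha, Finset.sum_insert ha, coeff_add, ih]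

theorem exists_of_coeff_mul_ne_zero [CommRing K] [AddCommMonoid Γ] [FiniteDecompositions Γ]
    {m : Γ} {f g : FormalToricRing K Γ} (h : coeff m (f * g) ≠ 0) :
    ∃ a b, a + b = m ∧ coeff a f ≠ 0 ∧ coeff b g ≠ 0 := by
  rw [coeff_mul] at h
  obtain ⟨p, hp, hne⟩ := Finset.exists_ne_zero_of_sum_ne_zero h
  exact ⟨p.1, p.2, mem_decompositions.1 hp, left_ne_zero_of_mul hne, right_ne_zero_of_mul hne⟩

theorem coeff_add_monomial_mul [CommRing K] [AddCancelCommMonoid Γ] [FiniteDecompositions Γ]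
    (t b : Γ) (g : FormalToricRing K Γ) : coeff (t + b) (monomial t * g) = coeff b g := by
  classical
  rw [coeff_mul, Finset.sum_eq_single (t, b)]
  · simp [coeff_monomial]
  · rintro ⟨x, y⟩ hp hne
    rw [mem_decompositions] at hp
    rw [coeff_monomial, if_neg, zero_mul]
    intro (hx : x = t)
    subst hx
    exact hne (by rw [add_left_cancel (show x + y = x + b from hp)])
  · simp

theorem coeff_monomial_mul_of_forall_ne [CommRing K] [AddCommMonoid Γ] [FiniteDecompositions Γ]
    {t n : Γ} (h : ∀ b, n ≠ t + b) (g : FormalToricRing K Γ) : coeff n (monomial t * g) = 0 := by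
  classical
  rw [coeff_mul]
  refine Finset.sum_eq_zero fun p hp => ?_
  rw [coeff_monomial, if_neg, zero_mul]
  intro hpt
  exact h p.2 (by rw [← mem_decompositions.1 hp, hpt])

/-- An ideal of `K[[Γ]]` contains every series all of whose exponents are exponents of monomials of
the ideal. -/
theorem mem_ideal_of_support [CommRing K] [AddCancelCommMonoid Γ] [AddMonoid.FG Γ]
    [FiniteDecompositions Γ] (J : Ideal (FormalToricRing K Γ)) (U : Set Γ)
    (hJ : ∀ n ∈ U, monomial n ∈ J) (h : FormalToricRing K Γ)
    (hh : ∀ n, coeff n h ≠ 0 → n ∈ U) : h ∈ J := by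
  classical
  obtain ⟨T, hTU, hT⟩ := exists_finset_generating U
  have key : ∀ T : Finset Γ, (∀ t ∈ T, monomial t ∈ J) → ∀ h : FormalToricRing K Γ,
      (∀ n, coeff n h ≠ 0 → ∃ t ∈ T, ∃ b, n = t + b) → h ∈ J := by
    intro T
    induction T using Finset.induction_on with
    | empty =>
      intro _ h hh
      have : h = 0 := by
        ext n
        by_contra hn
        obtain ⟨t, ht, -⟩ := hh n hn
        exact absurd ht (Finset.notMem_empty t)
      rw [this]
      exact J.zero_mem
    | insert t T _ ih =>
      intro hT h hh
      -- χ^t g collects all terms of h divisible by χ^t; the remaining exponents are covered by the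
      -- smaller set T.
      let g : FormalToricRing K Γ := mk fun b => coeff (t + b) h
      have h1 : monomial t * g ∈ J := J.mul_mem_right _ (hT t (Finset.mem_insert_self t T))
      rw [← sub_add_cancel h (monomial t * g)]
      refine J.add_mem (ih (fun s hs => hT s (Finset.mem_insert_of_mem hs)) _ ?_) h1
      intro n hn
      by_cases hb : ∃ b, n = t + b
      · obtain ⟨b, rfl⟩ := hb
        rw [coeff_sub, coeff_add_monomial_mul] at hn
        exact absurd (sub_self _) hn
      · rw [coeff_sub, coeff_monomial_mul_of_forall_ne (not_exists.1 hb), sub_zero] at hn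
        obtain ⟨s, hs, hsb⟩ := hh n hn
        rcases Finset.mem_insert.1 hs with rfl | hs
        · exact absurd hsb hb
        · exact ⟨s, hs, hsb⟩
  exact key T (fun t ht => hJ t (hTU t ht)) h fun n hn => hT n (hh n hn)

end Series

/-! ### Termwise estimates for valuations of series. -/

section Valuation

variable {A : Type v} [CommRing A]

/-- The ideal of the elements on which a nonnegative valuation exceeds a real number. -/
def ltIdeal (v : AddValuation A (WithTop ℝ)) (hv : ∀ f, 0 ≤ v f) (c : ℝ) : Ideal A where
  carrier := {f | (c : WithTop ℝ) < v f}
  zero_mem' := by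
    change _ < v 0
    rw [AddValuation.map_zero]
    exact WithTop.coe_lt_top c
  add_mem' := fun {a b} ha hb => (lt_min ha hb).trans_le (v.map_add a b)
  smul_mem' := fun a b hb => by
    change _ < v (a * b)
    rw [AddValuation.map_mul]
    exact (show (c : WithTop ℝ) < v b from hb).trans_le (le_add_of_nonneg_left (hv a))

/-- The ideal of the elements on which a nonnegative valuation is at least a given number. -/
def leIdeal (v : AddValuation A (WithTop ℝ)) (hv : ∀ f, 0 ≤ v f) (c : WithTop ℝ) : Ideal A where
  carrier := {f | c ≤ v f}
  zero_mem' := by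
    change _ ≤ v 0
    rw [AddValuation.map_zero]
    exact le_top
  add_mem' := fun {a b} ha hb => (le_min ha hb).trans (v.map_add a b)
  smul_mem' := fun a b hb => by
    change _ ≤ v (a * b)
    rw [AddValuation.map_mul]
    exact (show c ≤ v b from hb).trans (le_add_of_nonneg_left (hv a))

variable {K : Type v} [CommRing K] {Γ : Type u} [AddCancelCommMonoid Γ] [AddMonoid.FG Γ]
    [FiniteDecompositions Γ] (v : AddValuation (FormalToricRing K Γ) (WithTop ℝ))
    (hv : ∀ f, 0 ≤ v f)

include hv in
theorem lt_valuation_of_forall_coeff {c : ℝ} {h : FormalToricRing K Γ}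
    (hc : ∀ n, coeff n h ≠ 0 → (c : WithTop ℝ) < v (monomial n)) : (c : WithTop ℝ) < v h := by
  refine mem_ideal_of_support (ltIdeal v hv c) {n | (c : WithTop ℝ) < v (monomial n)}
    (fun n hn => hn) h hc

include hv in
theorem le_valuation_of_forall_coeff {c : WithTop ℝ} {h : FormalToricRing K Γ}
    (hc : ∀ n, coeff n h ≠ 0 → c ≤ v (monomial n)) : c ≤ v h := by
  refine mem_ideal_of_support (leIdeal v hv c) {n | c ≤ v (monomial n)}
    (fun n hn => hn) h hc

end Valuation

/-! ### Inversion of series with nonzero constant term. -/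

section Units

variable {K : Type v} [Field K] {Γ : Type u} [AddCancelCommMonoid Γ] [FiniteDecompositions Γ]
  [Subsingleton (AddUnits Γ)]

/-- Adding a to the first entry injects the decompositions of b into those of m and misses (0, m).
This is the termination measure for the recursive inverse. -/
theorem card_decompositions_lt {a b m : Γ} (h : a + b = m) (ha : a ≠ 0) :
    (decompositions b).card < (decompositions m).card := by
  classical
  have hinj : Function.Injective fun p : Γ × Γ => (a + p.1, p.2) := by
    rintro ⟨x, y⟩ ⟨x', y'⟩ hxy
    simp only [Prod.mk.injEq, add_right_inj] at hxy
    rw [hxy.1, hxy.2]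
  rw [← Finset.card_image_of_injective _ hinj]
  refine Finset.card_lt_card ((Finset.ssubset_iff_of_subset ?_).2 ⟨(0, m), ?_, ?_⟩)
  · intro p hp
    obtain ⟨q, hq, rfl⟩ := Finset.mem_image.1 hp
    rw [mem_decompositions] at hq ⊢
    rw [← h, ← hq, add_assoc]
  · rw [mem_decompositions, zero_add]
  · intro h0
    obtain ⟨q, -, hq⟩ := Finset.mem_image.1 h0
    exact ha (eq_zero_of_add_eq_zero (Prod.mk.inj hq).1)

open Classical in
/-- The coefficients of the inverse of a series with nonzero constant coefficient. -/
def invCoeff {K : Type v} [Field K] {Γ : Type u} [AddCancelCommMonoid Γ]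
    [FiniteDecompositions Γ] [Subsingleton (AddUnits Γ)] (f : FormalToricRing K Γ) (m : Γ) : K :=
  (coeff 0 f)⁻¹ * ((if m = 0 then 1 else 0) -
    ∑ p ∈ ((decompositions m).filter (·.1 ≠ 0)).attach, coeff p.1.1 f * invCoeff f p.1.2)
  termination_by (decompositions m).card
  decreasing_by
    exact card_decompositions_lt (mem_decompositions.1 (Finset.mem_filter.1 p.2).1)
      (Finset.mem_filter.1 p.2).2

theorem isUnit_of_coeff_zero_ne_zero {f : FormalToricRing K Γ} (hf : coeff 0 f ≠ 0) :
    IsUnit f := by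
  classical
  refine IsUnit.of_mul_eq_one (mk (invCoeff f)) ?_
  ext m
  have h0 : (0, m) ∈ decompositions m := by rw [mem_decompositions, zero_add]
  rw [coeff_mul, ← Finset.add_sum_erase _ _ h0]
  simp only [coeff_mk]
  rw [invCoeff, mul_inv_cancel_left₀ hf]
  have hs : (decompositions m).filter (·.1 ≠ 0) = (decompositions m).erase (0, m) := by
    ext p
    rw [Finset.mem_filter, Finset.mem_erase, and_comm, and_congr_left_iff]
    intro hp
    rw [mem_decompositions] at hp
    refine not_congr ⟨fun h => Prod.ext h ?_, fun h => by rw [h]⟩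
    rw [← hp, h, zero_add]
  rw [Finset.sum_attach _ fun p : Γ × Γ => coeff p.1 f * invCoeff f p.2]
  rw [hs, sub_add_cancel]
  change _ = coeff m (monomial 0)
  rw [coeff_monomial]

end Units

/-! ### Series supported on a subsemigroup. -/

section Inclusion

variable {K : Type v} [CommRing K] {Γ : Type u} [AddCommMonoid Γ]

open Classical in
/-- Extension by zero of series with exponents in a subsemigroup. -/
def extendSeries (S : AddSubmonoid Γ) (g : FormalToricRing K S) : FormalToricRing K Γ :=
  mk fun n => if h : n ∈ S then coeff ⟨n, h⟩ g else 0

theorem coeff_extendSeries (S : AddSubmonoid Γ) (g : FormalToricRing K S) (n : S) :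
    coeff (n : Γ) (extendSeries S g) = coeff n g := by
  simp [extendSeries]

theorem coeff_extendSeries_of_notMem {S : AddSubmonoid Γ} (g : FormalToricRing K S) {n : Γ}
    (hn : n ∉ S) : coeff n (extendSeries S g) = 0 := by
  simp [extendSeries, hn]

theorem extendSeries_monomial (S : AddSubmonoid Γ) (m : S) :
    extendSeries S (monomial m : FormalToricRing K S) = monomial (m : Γ) := by
  classical
  ext n
  by_cases hn : n ∈ S
  · lift n to S using hn
    rw [coeff_extendSeries, coeff_monomial, coeff_monomial]
    by_cases h : n = m
    · rw [if_pos h, if_pos (congrArg _ h)]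
    · rw [if_neg h, if_neg fun h' => h (Subtype.ext h')]
  · rw [coeff_extendSeries_of_notMem _ hn, coeff_monomial, if_neg]
    rintro rfl
    exact hn m.2

variable [FiniteDecompositions Γ]

/-- The inclusion `K[[S]] → K[[Γ]]` for a subsemigroup `S` of `Γ`. -/
def extendSeriesHom (S : AddSubmonoid Γ) : FormalToricRing K S →+* FormalToricRing K Γ where
  toFun := extendSeries S
  map_one' := extendSeries_monomial S 0
  map_zero' := by
    ext n
    by_cases hn : n ∈ S
    · lift n to S using hn
      rw [coeff_extendSeries]; rfl
    · rw [coeff_extendSeries_of_notMem _ hn]; rfl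
  map_add' f g := by
    ext n
    rw [coeff_add]
    by_cases hn : n ∈ S
    · lift n to S using hn
      simp only [coeff_extendSeries, coeff_add]
    · simp only [coeff_extendSeries_of_notMem _ hn, add_zero]
  map_mul' f g := by
    ext n
    by_cases hn : n ∈ S
    · lift n to S using hn
      rw [coeff_extendSeries, coeff_mul, coeff_mul]
      refine Finset.sum_of_injOn (fun p : S × S => ((p.1 : Γ), (p.2 : Γ))) ?_ ?_ ?_ ?_
      · rintro ⟨a, b⟩ - ⟨c, d⟩ - h
        simp only [Prod.mk.injEq, Subtype.ext_iff] at h ⊢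
        exact h
      · intro p hp
        have h := mem_decompositions.1 hp
        refine mem_decompositions.2 ?_
        rw [← h]; rfl
      · rintro ⟨a, b⟩ hp hne
        by_contra hab
        have ha : a ∈ S := by
          by_contra h; exact hab (by rw [coeff_extendSeries_of_notMem _ h, zero_mul])
        have hb : b ∈ S := by
          by_contra h; exact hab (by rw [coeff_extendSeries_of_notMem _ h, mul_zero])
        refine hne ⟨(⟨a, ha⟩, ⟨b, hb⟩), mem_decompositions.2 ?_, rfl⟩
        exact Subtype.ext (mem_decompositions.1 hp)
      · intro p _
        simp only [coeff_extendSeries]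
    · rw [coeff_extendSeries_of_notMem _ hn]
      by_contra h
      obtain ⟨a, b, hab, ha, hb⟩ := exists_of_coeff_mul_ne_zero (Ne.symm h)
      refine hn (hab ▸ add_mem ?_ ?_)
      · by_contra h; exact ha (coeff_extendSeries_of_notMem _ h)
      · by_contra h; exact hb (coeff_extendSeries_of_notMem _ h)

end Inclusion

/-! ### Homogeneous components and the ideal separating initial forms from monomials. -/

section Components

variable {K : Type v} [CommRing K] {Γ : Type u} [AddCancelCommMonoid Γ]

open Classical in
/-- The homogeneous component of weight `c` of a series. -/
def component (ω : Γ →+ WithTop ℝ) (c : ℝ) (f : FormalToricRing K Γ) : FormalToricRing K Γ :=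
  mk fun n => if ω n = c then coeff n f else 0

open Classical in
theorem coeff_component (ω : Γ →+ WithTop ℝ) (c : ℝ) (f : FormalToricRing K Γ) (n : Γ) :
    coeff n (component ω c f) = if ω n = c then coeff n f else 0 := rfl

variable [FiniteDecompositions Γ]

/-- A finite weight c of a sum forces both summands to have finite weight, so terms of infinite
weight do not contribute. D must contain every pair of attained weights with sum c. -/
theorem component_mul (ω : Γ →+ WithTop ℝ) (c : ℝ) (f g : FormalToricRing K Γ)
    (D : Finset (ℝ × ℝ)) (hD : ∀ x y, (∃ m, ω m = ((x : ℝ) : WithTop ℝ)) →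
      (∃ m, ω m = ((y : ℝ) : WithTop ℝ)) → x + y = c → (x, y) ∈ D)
    (hD' : ∀ p ∈ D, p.1 + p.2 = c) :
    component ω c (f * g) = ∑ p ∈ D, component ω p.1 f * component ω p.2 g := by
  classical
  ext n
  rw [coeff_component, coeff_sum]
  simp only [coeff_mul]
  split_ifs with hn
  · rw [Finset.sum_comm]
    refine Finset.sum_congr rfl ?_
    rintro ⟨a, b⟩ hab
    rw [mem_decompositions] at hab
    dsimp only at hab ⊢
    have hsum : ω a + ω b = c := by rw [← map_add, hab, hn]
    obtain ⟨ha, hb⟩ := WithTop.add_ne_top.1 (hsum.trans_ne WithTop.coe_ne_top)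
    lift ω a to ℝ using ha with x hx
    lift ω b to ℝ using hb with y hy
    rw [Finset.sum_eq_single (x, y)]
    · rw [coeff_component, coeff_component, if_pos hx.symm, if_pos hy.symm]
    · rintro ⟨x', y'⟩ _ hne
      rw [coeff_component, coeff_component, ← hx, ← hy]
      by_cases h1 : x = x'
      · have h2 : y ≠ y' := fun h2 => hne (by rw [h1, h2])
        rw [if_neg (fun h => h2 (WithTop.coe_injective h)), mul_zero]
      · rw [if_neg (fun h => h1 (WithTop.coe_injective h)), zero_mul]
    · intro h
      refine absurd (hD x y ⟨a, hx.symm⟩ ⟨b, hy.symm⟩ ?_) h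
      exact_mod_cast hsum
  · symm
    refine Finset.sum_eq_zero fun p hp => Finset.sum_eq_zero fun q hq => ?_
    rw [mem_decompositions] at hq
    rw [coeff_component, coeff_component]
    by_cases h1 : ω q.1 = p.1
    · rw [if_neg (c := ω q.2 = p.2), mul_zero]
      intro h2
      apply hn
      rw [← hq, map_add, h1, h2, ← WithTop.coe_add, hD' p hp]
    · rw [if_neg h1, zero_mul]

variable [AddMonoid.FG Γ]

/-- The ideal of the series `f` such that the value of `v` on every homogeneous component of `f`
exceeds the weight of the component. -/
def exceedingIdeal (v : AddValuation (FormalToricRing K Γ) (WithTop ℝ)) (hv : ∀ f, 0 ≤ v f)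
    (ω : Γ →+ WithTop ℝ) (hω : ∀ m, ω m = v (monomial m)) : Ideal (FormalToricRing K Γ) where
  carrier := {f | ∀ c : ℝ, component ω c f ∈ ltIdeal v hv c}
  zero_mem' := by
    classical
    intro c
    have : component ω c (0 : FormalToricRing K Γ) = 0 := by
      ext n
      simp [coeff_component]
    rw [this]
    exact Ideal.zero_mem _
  add_mem' := by
    classical
    intro f g hf hg c
    have : component ω c (f + g) = component ω c f + component ω c g := by
      ext n
      simp only [coeff_component, coeff_add]
      split_ifs <;> simp
    rw [this]
    exact Ideal.add_mem _ (hf c) (hg c)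
  smul_mem' := by
    classical
    intro f g hg c
    -- Well-ordering of the finite weights leaves finitely many pairs with sum c, so the component
    -- of a product is a finite sum.
    have hpwo := isPWO_weights ω fun m => (hω m).symm ▸ hv _
    have hfin := Set.AddAntidiagonal.finite_of_isPWO hpwo hpwo c
    rw [smul_eq_mul, component_mul ω c f g hfin.toFinset
      (fun x y hx hy hxy => hfin.mem_toFinset.2 ⟨hx, hy, hxy⟩)
      (fun p hp => (hfin.mem_toFinset.1 hp).2.2)]
    refine Ideal.sum_mem _ fun p hp => ?_
    have hpc : p.1 + p.2 = c := (hfin.mem_toFinset.1 hp).2.2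
    have h1 : (p.1 : WithTop ℝ) ≤ v (component ω p.1 f) := by
      refine le_valuation_of_forall_coeff v hv fun n hn => ?_
      rw [coeff_component] at hn
      rw [← hω]
      by_contra h
      exact hn (if_neg fun h' => h h'.ge)
    have h2 : (p.2 : WithTop ℝ) < v (component ω p.2 g) := hg p.2
    change (c : WithTop ℝ) < v (_ * _)
    rw [AddValuation.map_mul, ← hpc, WithTop.coe_add]
    exact WithTop.add_lt_add_of_le_of_lt WithTop.coe_ne_top h1 h2

end Components

/-! ### The inclusions of the theorem. -/

section Main

variable {K : Type v} [Field K] {Γ : Type u} [AddCancelCommMonoid Γ]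

/-- The restriction to `Γ` of an element of `L(σ, N)`. -/
def weightHom (w : LinearVariety Γ) : Γ →+ WithTop ℝ where
  toFun m := w (toLatticePoints m)
  map_zero' := by rw [toLatticePoints_zero, linearVariety_map_zero]
  map_add' a b := by rw [toLatticePoints_add, linearVariety_map_add]

theorem weightHom_apply (w : LinearVariety Γ) (m : Γ) :
    weightHom w m = w (toLatticePoints m) := rfl

/-- The nonnegative tropicalization is closed: it is the image of a compact space of valuations. -/
theorem closure_tropImage_subset {R : Type v} [CommRing R] (γ : Multiplicative Γ →* R)
    {W : Set (AddValuation R (WithTop ℝ))} (hW : W ⊆ nonnegValuations R) :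
    closure (tropImage γ W) ⊆ nntrop γ := by
  classical
  intro w hw
  obtain ⟨U, hU, hUw⟩ := mem_closure_iff_ultrafilter.1 hw
  obtain ⟨w₁, v₁, hv₁, -⟩ := U.nonempty_of_mem hU
  -- Points outside the image receive the arbitrary value v₁; the ultrafilter contains the image, so
  -- this choice does not affect limits.
  have hch : ∀ x : LinearVariety Γ, ∃ v ∈ nonnegValuations R, x ∈ tropImage γ W →
      ∀ m : Γ, x (toLatticePoints m) = v (γ (Multiplicative.ofAdd m)) := by
    intro x
    by_cases hx : x ∈ tropImage γ W
    · obtain ⟨v, hv, h⟩ := hx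
      exact ⟨v, hW hv, fun _ => h⟩
    · exact ⟨v₁, hW hv₁, fun h => absurd h hx⟩
  choose V hV hVγ using hch
  obtain ⟨v₀, hv₀, hlim⟩ := exists_nonnegValuation_tendsto U V hV
  refine ⟨v₀, hv₀, fun m => ?_⟩
  have hcont : Continuous fun x : LinearVariety Γ => x (toLatticePoints m) :=
    (continuous_apply (toLatticePoints m)).comp
      (continuous_induced_dom (f := fun x : LinearVariety Γ => (x : latticePoints Γ → WithTop ℝ)))
  have h1 : Filter.Tendsto (fun x : LinearVariety Γ => expNeg (x (toLatticePoints m))) U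
      (𝓝 (expNeg (w (toLatticePoints m)))) :=
    ((continuous_expNeg.comp hcont).tendsto w).mono_left hUw
  have h2 := hlim (γ (Multiplicative.ofAdd m))
  refine expNeg_injective (tendsto_nhds_unique (h1.congr' ?_) h2)
  filter_upwards [hU] with x hx
  rw [hVγ x hx m]

variable [AddMonoid.FG Γ] [Subsingleton (AddUnits Γ)]

/-- The valuation on `K[[Γ]]` induced by a valuation of a quotient. -/
def pullback (I : Ideal (FormalToricRing K Γ))
    (v : AddValuation (FormalToricRing K Γ ⧸ I) (WithTop ℝ)) :
    AddValuation (FormalToricRing K Γ) (WithTop ℝ) :=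
  v.comap (Ideal.Quotient.mk I)

theorem pullback_apply (I : Ideal (FormalToricRing K Γ))
    (v : AddValuation (FormalToricRing K Γ ⧸ I) (WithTop ℝ)) (f : FormalToricRing K Γ) :
    pullback I v f = v (Ideal.Quotient.mk I f) := rfl

theorem pullback_of_mem {I : Ideal (FormalToricRing K Γ)}
    (v : AddValuation (FormalToricRing K Γ ⧸ I) (WithTop ℝ)) {f : FormalToricRing K Γ}
    (hf : f ∈ I) : pullback I v f = ⊤ := by
  rw [pullback_apply, Ideal.Quotient.eq_zero_iff_mem.2 hf, AddValuation.map_zero]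

/-- Nonnegativity forces value 0 on units. A representative of a nonunit has no constant term, so
the termwise estimate makes its value positive. -/
theorem localValuations_of_pos (I : Ideal (FormalToricRing K Γ))
    {v : AddValuation (FormalToricRing K Γ ⧸ I) (WithTop ℝ)} (hv : v ∈ nonnegValuations _)
    (hpos : ∀ m : Γ, m ≠ 0 → 0 < pullback I v (monomial m)) : v ∈ localValuations _ := by
  refine ⟨hv, Set.ext fun f => ⟨fun hf hu => ?_, fun hf => ?_⟩⟩
  · obtain ⟨g, hg⟩ := hu.exists_right_inv
    have h1 : v f + v g = 0 := by rw [← AddValuation.map_mul, hg, AddValuation.map_one]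
    have h2 : v f ≤ 0 := by
      rw [← h1]
      exact le_add_of_nonneg_right (hv g)
    exact absurd (show 0 < v f from hf) h2.not_gt
  · obtain ⟨F, rfl⟩ := Ideal.Quotient.mk_surjective f
    have h0 : coeff 0 F = 0 := by
      by_contra h
      exact hf ((isUnit_of_coeff_zero_ne_zero h).map _)
    have := lt_valuation_of_forall_coeff (pullback I v) (fun f => hv _) (c := 0) (h := F)
      (fun n hn => hpos n fun h => hn (h ▸ h0))
    exact this

/-- The closure is not needed here: the very valuation that realizes an interior point is local. -/
theorem nntrop_inter_subset_ptrop (I : Ideal (FormalToricRing K Γ)) :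
    nntropIdeal I ∩ extendedConeInterior Γ ⊆ ptropIdeal I := by
  rintro w ⟨⟨v, hv, hw⟩, hint⟩
  refine ⟨subset_closure ⟨v, localValuations_of_pos I hv fun m hm => ?_, hw⟩, hint⟩
  exact (hint.2 _ (not_isAddUnit_toLatticePoints hm)).trans_eq (hw m)

/-- Local tropicalizations have monomial free initial ideals. -/
theorem nntrop_subset_monomialFreeLocus (I : Ideal (FormalToricRing K Γ)) :
    nntropIdeal I ⊆ monomialFreeLocus I := by
  classical
  rintro w ⟨v, hv, hw⟩
  obtain ⟨τ, hτ, hwτ⟩ := exists_isFaceOf_mem_stratum w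
  refine ⟨(mem_extendedCone_iff w).2 fun m => (hw m).symm ▸ hv _, τ, hτ, hwτ, ?_⟩
  have hv' : ∀ f, 0 ≤ pullback I v f := fun f => hv _
  have hω : ∀ m, weightHom w m = pullback I v (monomial m) := hw
  let ι := extendSeriesHom (K := K) (truncSubmonoid τ)
  have hle : initialIdeal τ w I ≤
      (exceedingIdeal (pullback I v) hv' (weightHom w) hω).comap ι := by
    rw [initialIdeal, Ideal.span_le]
    rintro _ ⟨f, hf, rfl⟩ c
    set g := initForm (weight τ w) (truncation τ f)
    by_cases hc : ∀ n, coeff n (component (weightHom w) c (ι g)) = 0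
    · have : component (weightHom w) c (ι g) = 0 := FormalToricRing.ext hc
      rw [this]
      exact Ideal.zero_mem _
    obtain ⟨n₀, hn₀⟩ := not_forall.1 hc
    rw [coeff_component] at hn₀
    have hwn₀ : weightHom w n₀ = c := by by_contra h; exact hn₀ (if_neg h)
    rw [if_pos hwn₀] at hn₀
    have hn₀τ : n₀ ∈ truncSubmonoid τ := by
      by_contra h; exact hn₀ (coeff_extendSeries_of_notMem g h)
    lift n₀ to truncSubmonoid τ using hn₀τ
    have hg : ∀ n : truncSubmonoid τ, coeff n g =
        if ∀ k, coeff k (truncation τ f) ≠ 0 → weight τ w n ≤ weight τ w k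
          then coeff (n : Γ) f else 0 := fun n => by
      simp only [g, initForm, coeff_mk]; rfl
    have hmin : ∀ k : truncSubmonoid τ, coeff (k : Γ) f ≠ 0 →
        (c : WithTop ℝ) ≤ weightHom w (k : Γ) := by
      intro k hk
      have hn₁ : coeff n₀ g ≠ 0 := fun h => hn₀ ((coeff_extendSeries _ g n₀).trans h)
      rw [hg] at hn₁
      by_contra hlt
      refine hn₁ (if_neg fun h => hlt ?_)
      rw [← hwn₀]
      exact h k hk
    have hgw : ∀ n : truncSubmonoid τ, coeff n g ≠ 0 → weightHom w (n : Γ) = c := by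
      intro n hn
      rw [hg] at hn
      have hmn : ∀ k, coeff k (truncation τ f) ≠ 0 → weight τ w n ≤ weight τ w k := by
        by_contra h; exact hn (if_neg h)
      rw [if_pos hmn] at hn
      refine le_antisymm ?_ (hmin n hn)
      have hn₁ : coeff n₀ g ≠ 0 := fun h => hn₀ ((coeff_extendSeries _ g n₀).trans h)
      rw [hg] at hn₁
      rw [← hwn₀]
      refine hmn n₀ fun h => hn₁ ?_
      split_ifs
      · exact h
      · rfl
    have hcomp : component (weightHom w) c (ι g) = ι g := by
      ext n
      rw [coeff_component]
      split_ifs with h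
      · rfl
      · by_cases hn : n ∈ truncSubmonoid τ
        · lift n to truncSubmonoid τ using hn
          by_contra hne
          refine h (hgw n fun h0 => hne ?_)
          exact ((coeff_extendSeries _ g n).trans h0).symm
        · exact (coeff_extendSeries_of_notMem g hn).symm
    rw [hcomp]
    -- Subtracting the initial form leaves terms in Γ_τ of weight > c and terms outside Γ_τ, whose
    -- weight is infinite. As v(f) = ∞, it follows that v(g) > c.
    have hdiff : f - ι g ∈ ltIdeal (pullback I v) hv' c := by
      refine lt_valuation_of_forall_coeff (pullback I v) hv' fun n hn => ?_
      rw [← hω]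
      by_cases hnτ : n ∈ truncSubmonoid τ
      · lift n to truncSubmonoid τ using hnτ
        have hιn : coeff (n : Γ) (ι g) = coeff n g := coeff_extendSeries _ g n
        rw [coeff_sub, hιn] at hn
        have hfn : coeff (n : Γ) f ≠ 0 := by
          intro h
          apply hn
          rw [hg, h]
          simp
        refine lt_of_le_of_ne (hmin n hfn) fun hcn => hn ?_
        rw [hg, if_pos, sub_self]
        intro k hk
        exact (hcn.symm.trans_le (hmin k hk))
      · rw [mem_truncSubmonoid_iff hwτ, not_not] at hnτ
        rw [weightHom_apply, hnτ]
        exact WithTop.coe_lt_top c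
    have hf' : f ∈ ltIdeal (pullback I v) hv' c := by
      change _ < pullback I v f
      rw [pullback_of_mem v hf]
      exact WithTop.coe_lt_top c
    rw [← sub_sub_cancel f (ι g)]
    exact Ideal.sub_mem _ hf' hdiff
  intro m hm
  have hmτ := (mem_truncSubmonoid_iff hwτ (m : Γ)).1 m.2
  obtain ⟨c, hc⟩ := WithTop.ne_top_iff_exists.1 hmτ
  have h1 : component (weightHom w) c (ι (monomial m)) ∈ ltIdeal (pullback I v) hv' c := hle hm c
  have h2 : component (weightHom w) c (ι (monomial m)) = monomial (m : Γ) := by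
    have : ι (monomial m) = monomial (m : Γ) := extendSeries_monomial _ m
    rw [this]
    ext n
    rw [coeff_component, coeff_monomial]
    by_cases hn : n = m
    · rw [if_pos]
      rw [hn, weightHom_apply, hc]
    · rw [if_neg hn, ite_self]
  rw [h2] at h1
  change (c : WithTop ℝ) < pullback I v (monomial (m : Γ)) at h1
  rw [← hω, weightHom_apply, ← hc] at h1
  exact lt_irrefl _ h1

/-- `f` is congruent modulo `I` to a series all of whose terms have absolute value
at most `r`. -/
def IsBoundedMod (I : Ideal (FormalToricRing K Γ)) (ω : Γ →+ WithTop ℝ) (r : ℝ)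
    (f : FormalToricRing K Γ) : Prop :=
  0 ≤ r ∧ ∃ g, g - f ∈ I ∧ ∀ n, coeff n g ≠ 0 → expNeg (ω n) ≤ r

/-- The quotient seminorm modulo `I` of the weighted maximum seminorm on `K[[Γ]]`. -/
theorem exists_quotient_seminorm (I : Ideal (FormalToricRing K Γ)) (ω : Γ →+ WithTop ℝ)
    (hω : ∀ m, 0 ≤ ω m) :
    ∃ μ : RingSeminorm (FormalToricRing K Γ), IsNonarchimedean μ ∧
      (∀ f r, IsBoundedMod I ω r f → μ f ≤ r) ∧
      ∀ f r, μ f < r → ∃ s < r, IsBoundedMod I ω s f := by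
  let μ : FormalToricRing K Γ → ℝ := fun f => sInf {r | IsBoundedMod I ω r f}
  have hbdd : ∀ f, BddBelow {r | IsBoundedMod I ω r f} := fun f => ⟨0, fun r hr => hr.1⟩
  have hone : ∀ f, IsBoundedMod I ω 1 f := fun f =>
    ⟨zero_le_one, f, by rw [sub_self]; exact I.zero_mem, fun n _ => expNeg_le_one (hω n)⟩
  have hle : ∀ f r, IsBoundedMod I ω r f → μ f ≤ r := fun f r h => csInf_le (hbdd f) h
  have hlt : ∀ f r, μ f < r → ∃ s < r, IsBoundedMod I ω s f := fun f r h => by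
    obtain ⟨s, hs, hsr⟩ := exists_lt_of_csInf_lt ⟨1, hone f⟩ h
    exact ⟨s, hsr, hs⟩
  have hnn : ∀ f, 0 ≤ μ f := fun f => le_csInf ⟨1, hone f⟩ fun r hr => hr.1
  have hna : IsNonarchimedean μ := by
    intro f g
    refine le_of_forall_gt_imp_ge_of_dense fun a ha => ?_
    obtain ⟨r, hr, hr0, F, hFI, hF⟩ := hlt f a ((le_max_left _ _).trans_lt ha)
    obtain ⟨s, hs, hs0, G, hGI, hG⟩ := hlt g a ((le_max_right _ _).trans_lt ha)
    refine hle _ _ ⟨hr0.trans hr.le, F + G, ?_, fun n hn => ?_⟩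
    · rw [add_sub_add_comm]
      exact I.add_mem hFI hGI
    · by_cases hFn : coeff n F = 0
      · rw [coeff_add, hFn, zero_add] at hn
        exact (hG n hn).trans hs.le
      · exact (hF n hFn).trans hr.le
  have hneg : ∀ f r, IsBoundedMod I ω r f → IsBoundedMod I ω r (-f) := by
    rintro f r ⟨hr, F, hFI, hF⟩
    refine ⟨hr, -F, ?_, fun n hn => hF n fun h => hn ?_⟩
    · rw [neg_sub_neg, ← neg_sub]
      exact I.neg_mem hFI
    · rw [coeff_neg, h, neg_zero]
  refine ⟨{ toFun := μ
            map_zero' := le_antisymm (hle _ _ ⟨le_rfl, 0, by rw [sub_zero]; exact I.zero_mem,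
              fun n hn => absurd rfl hn⟩) (hnn 0)
            add_le' := fun x y => (hna x y).trans (max_le_add_of_nonneg (hnn x) (hnn y))
            neg' := fun f => by
              have : {r | IsBoundedMod I ω r (-f)} = {r | IsBoundedMod I ω r f} := by
                ext r
                exact ⟨fun h => neg_neg f ▸ hneg _ _ h, hneg _ _⟩
              simp only [μ, this]
            mul_le' := fun x y => ?_ }, hna, hle, hlt⟩
  have key : ∀ ε > 0, μ (x * y) ≤ (μ x + ε) * (μ y + ε) := by
    intro ε hε
    obtain ⟨r, hr, hr0, F, hFI, hF⟩ := hlt x (μ x + ε) (by linarith)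
    obtain ⟨s, hs, hs0, G, hGI, hG⟩ := hlt y (μ y + ε) (by linarith)
    refine (hle _ (r * s) ⟨mul_nonneg hr0 hs0, F * G, ?_, fun n hn => ?_⟩).trans
      (mul_le_mul hr.le hs.le hs0 (hr0.trans hr.le))
    · have : F * G - x * y = (F - x) * G + x * (G - y) := by ring
      rw [this]
      exact I.add_mem (I.mul_mem_right _ hFI) (I.mul_mem_left _ hGI)
    · obtain ⟨a, b, rfl, ha, hb⟩ := exists_of_coeff_mul_ne_zero hn
      rw [map_add, expNeg_add]
      exact mul_le_mul (hF a ha) (hG b hb) (expNeg_nonneg _) hr0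
  have ht : Filter.Tendsto (fun ε : ℝ => (μ x + ε) * (μ y + ε)) (𝓝[>] 0)
      (𝓝 ((μ x + 0) * (μ y + 0))) :=
    ((Continuous.tendsto (by fun_prop) 0)).mono_left nhdsWithin_le_nhds
  rw [add_zero, add_zero] at ht
  exact ge_of_tendsto ht (Filter.eventually_of_mem self_mem_nhdsWithin key)

/-- A point of the extended cone with monomial free initial ideal comes from a valuation. -/
theorem monomialFreeLocus_subset_nntrop (I : Ideal (FormalToricRing K Γ)) :
    monomialFreeLocus I ⊆ nntropIdeal I := by
  classical
  rintro w ⟨hw, τ, -, hwτ, hfree⟩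
  have hω : ∀ m, 0 ≤ weightHom w m := fun m => hw _
  obtain ⟨μ, hna, hle, hlt⟩ := exists_quotient_seminorm I (weightHom w) hω
  have hμle : ∀ m, μ (monomial m) ≤ expNeg (weightHom w m) := fun m =>
    hle _ _ ⟨expNeg_nonneg _, monomial m, by rw [sub_self]; exact I.zero_mem, fun n hn => by
      rw [coeff_monomial] at hn
      have : n = m := by by_contra h; exact hn (if_neg h)
      rw [this]⟩
  -- The only use of monomial freeness: a strict inequality gives G congruent to χ^m modulo I with
  -- all weights > w(m), so χ^m is the initial form of χ^m - G ∈ I.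
  have hμmon : ∀ m ∈ truncSubmonoid τ, μ (monomial m) = expNeg (weightHom w m) := by
    intro m hm
    refine le_antisymm (hμle m) (not_lt.1 fun h => ?_)
    obtain ⟨r, hr, -, G, hGI, hG⟩ := hlt _ _ h
    have hGw : ∀ n, coeff n G ≠ 0 → weightHom w m < weightHom w n := fun n hn =>
      expNeg_strictAnti.lt_iff_gt.1 ((hG n hn).trans_lt hr)
    have hGm : coeff m G = 0 := by
      by_contra h
      exact lt_irrefl _ (hGw m h)
    lift m to truncSubmonoid τ using hm
    refine hfree m (Ideal.subset_span ⟨monomial (m : Γ) - G, ?_, ?_⟩)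
    · rw [← neg_sub]
      exact I.neg_mem hGI
    · have hF : ∀ n : truncSubmonoid τ, coeff n (truncation τ (monomial (m : Γ) - G)) =
          (if n = m then (1 : K) else 0) - coeff (n : Γ) G := by
        intro n
        change coeff (n : Γ) (monomial (m : Γ) : FormalToricRing K Γ) - coeff (n : Γ) G = _
        rw [coeff_monomial]
        by_cases h : n = m
        · rw [if_pos h, if_pos (congrArg _ h)]
        · rw [if_neg h, if_neg fun h' => h (Subtype.ext h')]
      ext n
      rw [coeff_monomial, initForm, coeff_mk]
      by_cases hn : n = m
      · subst hn
        rw [if_pos rfl, if_pos, hF, if_pos rfl, hGm, sub_zero]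
        intro k hk
        rw [hF] at hk
        by_cases hkn : k = n
        · rw [hkn]
        · rw [if_neg hkn, zero_sub, neg_ne_zero] at hk
          exact (hGw _ hk).le
      · rw [if_neg hn]
        split_ifs with hmin
        · rw [hF, if_neg hn, zero_sub, zero_eq_neg]
          by_contra hne
          refine (hGw _ hne).not_ge (hmin m ?_)
          rw [hF, if_pos rfl, hGm, sub_zero]
          exact one_ne_zero
        · rfl
  have hμ1 : μ 1 = 1 := by
    have := hμmon 0 (zero_mem _)
    rw [map_zero, expNeg_zero] at this
    exact this
  let S : Submonoid (FormalToricRing K Γ) :=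
    { carrier := {s | ∃ m ∈ truncSubmonoid τ, s = monomial m}
      one_mem' := ⟨0, zero_mem _, rfl⟩
      mul_mem' := by
        rintro _ _ ⟨m, hm, rfl⟩ ⟨n, hn, rfl⟩
        exact ⟨m + n, add_mem hm hn, monomial_mul_monomial m n⟩ }
  obtain ⟨f, hfna, hfmul, hfle, hfS⟩ := exists_multiplicative_seminorm_le μ hna S hμ1
    (by
      rintro _ ⟨m, hm, rfl⟩
      rw [hμmon m hm]
      exact expNeg_ne_zero ((mem_truncSubmonoid_iff hwτ m).1 hm))
    (by
      rintro _ ⟨m, hm, rfl⟩ _ ⟨n, hn, rfl⟩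
      rw [monomial_mul_monomial, hμmon _ (add_mem hm hn), hμmon m hm, hμmon n hn, map_add,
        expNeg_add])
  have hf1 : f 1 = 1 := (hfS 1 S.one_mem).trans hμ1
  have hfI : ∀ g ∈ I, f g = 0 := fun g hg =>
    le_antisymm ((hfle g).trans (hle _ _ ⟨le_rfl, 0, by rw [zero_sub]; exact I.neg_mem hg,
      fun n hn => absurd rfl hn⟩)) (apply_nonneg f g)
  let v := valuationOfSeminorm f (apply_nonneg f) (map_zero f) hf1 hfmul hfna
  have hvf : ∀ x, expNeg (v x) = f x := expNeg_valuationOfSeminorm _ _ _ _ _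
  have hvI : I ≤ v.supp := fun g hg => by
    rw [AddValuation.mem_supp_iff]
    exact expNeg_injective ((hvf g).trans (hfI g hg))
  have hv0 : v ∈ nonnegValuations _ := valuationOfSeminorm_nonneg _ _ _ _ _ fun x =>
    (hfle x).trans (hle _ _ ⟨zero_le_one, x, by rw [sub_self]; exact I.zero_mem,
      fun n _ => expNeg_le_one (hω n)⟩)
  refine ⟨v.onQuot hvI, fun g => ?_, fun m => ?_⟩
  · obtain ⟨F, rfl⟩ := Ideal.Quotient.mk_surjective g
    exact hv0 F
  · change weightHom w m = v (monomial m)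
    apply expNeg_injective
    rw [hvf]
    by_cases hm : m ∈ truncSubmonoid τ
    · rw [hfS _ ⟨m, hm, rfl⟩, hμmon m hm]
    -- Outside Γ_τ no value was prescribed, but f ≤ μ ≤ exp(-∞) = 0 there.
    · have htop : weightHom w m = ⊤ := not_not.1 ((mem_truncSubmonoid_iff hwτ m).not.1 hm)
      have h := (hfle _).trans (hμle m)
      rw [htop, expNeg_top] at h ⊢
      exact le_antisymm (apply_nonneg f _) h

end Main

end LocalTrop

end


/-- For an ideal `I` of `K[[Γ]]`, with `Γ` a pointed affine semigroup, (i) the local positive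
tropicalization is the part of the local nonnegative tropicalization lying in the interior of the
extended cone, and (ii) the local nonnegative tropicalization is the set of the points of the
extended cone whose initial ideal is monomial free. -/
theorem mainTheorem2 {K : Type*} [Field K] {Γ : Type*} [AddCancelCommMonoid Γ] [AddMonoid.FG Γ]
    [IsAddTorsionFree Γ] [Subsingleton (AddUnits Γ)]
    (I : Ideal (LocalTrop.FormalToricRing K Γ)) :
    LocalTrop.ptropIdeal I = LocalTrop.nntropIdeal I ∩ LocalTrop.extendedConeInterior Γ ∧
      LocalTrop.nntropIdeal I = LocalTrop.monomialFreeLocus I := by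
  refine ⟨Set.Subset.antisymm ?_ (LocalTrop.nntrop_inter_subset_ptrop I),
    Set.Subset.antisymm (LocalTrop.nntrop_subset_monomialFreeLocus I)
      (LocalTrop.monomialFreeLocus_subset_nntrop I)⟩
  exact fun w hw => ⟨LocalTrop.closure_tropImage_subset _ (fun v hv => hv.1) hw.1, hw.2⟩
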